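/- Let $\Psi$ be the class of functions $\varphi:\mathbb R\to\mathbb R$ that are even, convex and $C^1$, with $\varphi(0)=\varphi'(0)=0$, such that $\varphi'$ is concave on $[0,\infty)$, $\varphi'$ is differentiable at $0$ with $\varphi''(0)=1$, and $\lim_{x\to\infty}\varphi'(x)/x=0$. For probability measures $\mu,\nu$ on $\mathbb R$ set $$\kappa_\varphi(\mu,\nu)=\inf\{E\,\varphi(Y-Z)\,:\,Y\sim\mu,\ Z\sim\nu\}\in[0,\infty],\qquad W_\varphi(\mu,\nu)=\kappa_\varphi(\mu,\nu)^{1/2}.$$ Let $(X_i)_{i\in\mathbb Z}$ be a sequence of i.i.d. real random variables that are centered and in $L^3$, with variance $\sigma^2>0$; let $X$ have the law of $X_1$, and put $S_n=X_1+\dots+X_n$, $\mu_3=E(X^3)$, $\lambda_3=E(|X|^3)$ and $$C_0(X)=\gamma_1\sigma^2+\sigma^{-4}\left(\gamma_0\lambda_3^2+\gamma_3\mu_3^2\right),\qquad \gamma_0=\tfrac35,\quad \gamma_1=3.0376,\quad \gamma_2=0.64584,\quad \gamma_3=1.6917 .$$ Let $P_{S_n}$ be the law of $S_n$ and let $P_{G_{n\sigma^2}}$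 be the normal law $\mathcal N(0,n\sigma^2)$. Then for every $\varphi\in\Psi$ and every integer $n\ge1$, $$W_\varphi(P_{S_n},P_{G_{n\sigma^2}})\le\sqrt{2C_0(X)+8\gamma_2\sigma^{-2}\,E\!\left(|X|^3\varphi'(|X|/4)\right)}+1.369\,\sigma^{-2}|\mu_3|,$$ where the right-hand side is $+\infty$ if the expectation is infinite. Consequently, if $E\left(X^2\varphi(|X|)\right)<\infty$, then $\sup_{n\ge1}W_\varphi(P_{S_n},P_{G_{n\sigma^2}})<\infty$. -/

import Mathlib

open MeasureTheory ProbabilityTheory Filter Topology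
open scoped ENNReal

/-- The class `Ψ` of cost functions. As `φ` is even, `φ'` is odd; "`φ'` is concave" is therefore
concavity on the half-line `[0, ∞)`. -/
structure CostClass (φ : ℝ → ℝ) : Prop where
  even : ∀ x, φ (-x) = φ x
  convex : ConvexOn ℝ Set.univ φ
  contDiff : ContDiff ℝ 1 φ
  zero : φ 0 = 0
  deriv_zero : deriv φ 0 = 0
  concave_deriv : ConcaveOn ℝ (Set.Ici 0) (deriv φ)
  hasDerivAt_deriv : HasDerivAt (deriv φ) 1 0
  tendsto_deriv_div : Tendsto (fun x => deriv φ x / x) atTop (𝓝 0)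

/-- The set of couplings of `μ` and `ν`: laws of pairs `(X, Y)` with `X ∼ μ` and `Y ∼ ν`. -/
def couplings (μ ν : Measure ℝ) : Set (Measure (ℝ × ℝ)) :=
  {π | π.map Prod.fst = μ ∧ π.map Prod.snd = ν}

/-- The transport cost `κ_φ(μ, ν) = inf {E φ(X - Y) : X ∼ μ, Y ∼ ν} ∈ [0, ∞]`, for `φ ≥ 0`. -/
noncomputable def transportCost (φ : ℝ → ℝ) (μ ν : Measure ℝ) : ℝ≥0∞ :=
  ⨅ π ∈ couplings μ ν, ∫⁻ z, ENNReal.ofReal (φ (z.1 - z.2)) ∂π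

/-- `W_φ(μ, ν) = κ_φ(μ, ν)^{1/2}`. -/
noncomputable def transportDist (φ : ℝ → ℝ) (μ ν : Measure ℝ) : ℝ≥0∞ :=
  transportCost φ μ ν ^ (1 / 2 : ℝ)

/-- `C₀ = γ₁ σ² + σ⁻⁴ (γ₀ λ₃² + γ₃ μ₃²)` with `γ₀ = 3/5`, `γ₁ = 3.0376`, `γ₃ = 1.6917`, where
`σ² = E Y²`, `λ₃ = E |Y|³`, `μ₃ = E Y³` for the centered random variable `Y`. -/
noncomputable def constC₀ {Ω : Type*} [MeasurableSpace Ω] (P : Measure Ω) (Y : Ω → ℝ) : ℝ :=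
  3.0376 * (∫ ω, Y ω ^ 2 ∂P)
    + ((∫ ω, Y ω ^ 2 ∂P) ^ 2)⁻¹ *
      (3 / 5 * (∫ ω, |Y ω| ^ 3 ∂P) ^ 2 + 1.6917 * (∫ ω, Y ω ^ 3 ∂P) ^ 2)

/-! The law of `S_n` is compared with the law `ν` of a slightly skewed Gaussian, `G + c (G² / v -
1)`, where `G ∼ N(0, v)`, `v = n σ²` and `c = μ₃ / (6 σ²)`. The square root of a function of `Ψ` is
subadditive, so Minkowski's inequality makes `W_φ` satisfy the triangle inequality
(`transportDist_triangle`). Since `φ x ≤ x² / 2`, moving `G` to its skewed version costs at most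
`c²`, which gives the term linear in `|μ₃|`. It remains to bound `κ_φ(P_{S_n}, ν)` by a constant
free of `n`.

Duality (`exists_transportCost_le`): couple the two laws by their quantile functions `Y` and `Z`. By
monotonicity the intervals on which `Y` exceeds `Z` never meet those on which `Z` exceeds `Y`, so a
signed distance function `s`, which is 1-Lipschitz, sees both families at once. A primitive `f` of
`φ' ∘ s` then satisfies `φ (Y - Z) ≤ 2 (f Y - f Z)`, and the cost is at most `2 (E f(S_n) - ∫ f
dν)`. All that is retained of `f` is that `f' = p = φ' ∘ s` with `s` 1-Lipschitz.

Stein's method: with `g` solving `v g'' - x g' - g = p`, one has `E f(S_n) - E f(G) = E[v g'(S_n) -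
S_n g(S_n)]`. The solution is explicit in terms of iterated integrals of the normal distribution
function, and identities between these integrals show that `g''` is bounded by `2 ‖p‖ / v` and has
Lipschitz constant at most `2 / v` times that of `p`. Expanding each summand around the sum of the
others leaves `-(μ₃ / 2) E g''(G)` up to an error of order `1 / v`; summing `n` such errors gives a
constant. The Taylor remainder is of size `|X|³ φ'(|X| / 4) / v`: `p` is split, at a level depending
on `|X|`, into a bounded part and a part with small Lipschitz constant (`exists_split`,
`abs_remainder_le`).

The leading term `-(n μ₃ / 2) E g''(G)` is not bounded in this way, but Gaussian integration by
parts gives `E[p(G) (G² / v - 1)] = -3 v E g''(G)` (`integral_hermite`). Hence the skewing changes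
`E f(G)` by the same amount up to `c²`, and the choice of `c` makes the two cancel
(`CenteredFamily.transportCost_le`). -/

namespace CostClass

/-! ### Analysis of the cost functions. -/

variable {φ : ℝ → ℝ}

lemma continuous_deriv (h : CostClass φ) : Continuous (deriv φ) :=
  h.contDiff.continuous_deriv le_rfl

lemma differentiable (h : CostClass φ) : Differentiable ℝ φ :=
  h.contDiff.differentiable one_ne_zero

lemma hasDerivAt (h : CostClass φ) (x : ℝ) : HasDerivAt φ (deriv φ x) x :=
  (h.differentiable x).hasDerivAt

lemma deriv_neg (h : CostClass φ) (x : ℝ) : deriv φ (-x) = -deriv φ x := by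
  have h1 : (fun y => φ (-y)) = φ := funext h.even
  have h2 := deriv_comp_neg φ x
  rw [h1] at h2
  linarith

lemma deriv_monotone (h : CostClass φ) : Monotone (deriv φ) := by
  have := h.convex.monotoneOn_deriv (fun x _ => h.differentiable x)
  exact fun x y hxy => this (Set.mem_univ x) (Set.mem_univ y) hxy

lemma deriv_nonneg (h : CostClass φ) {x : ℝ} (hx : 0 ≤ x) : 0 ≤ deriv φ x := by
  have := h.deriv_monotone hx
  rwa [h.deriv_zero] at this

/-- Concavity between `0` and `x`, with `φ' 0 = 0`. Equivalently, `φ' x / x` is nonincreasing on the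
positive half-line. -/
lemma mul_deriv_le (h : CostClass φ) {l x : ℝ} (hl : 0 ≤ l) (hl1 : l ≤ 1) (hx : 0 ≤ x) :
    l * deriv φ x ≤ deriv φ (l * x) := by
  have := h.concave_deriv.2 (Set.mem_Ici.2 le_rfl) (Set.mem_Ici.2 hx) (sub_nonneg.2 hl1) hl
    (by ring)
  simpa [h.deriv_zero] using this

/-- The nonincreasing ratio `φ' x / x` has limit `φ''(0) = 1` at `0`. -/
lemma deriv_le (h : CostClass φ) {x : ℝ} (hx : 0 ≤ x) : deriv φ x ≤ x := by
  rcases hx.eq_or_lt with rfl | hx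
  · simp [h.deriv_zero]
  have h1 := (hasDerivAt_iff_tendsto_slope_zero.1 h.hasDerivAt_deriv).mono_left
    (nhdsWithin_mono 0 (fun y (hy : (0 : ℝ) < y) => hy.ne') : 𝓝[>] (0 : ℝ) ≤ _)
  have h2 : deriv φ x / x ≤ 1 := by
    refine ge_of_tendsto h1 ?_
    filter_upwards [Ioo_mem_nhdsGT hx] with t ht
    have := h.mul_deriv_le (l := t / x) (by have := ht.1; positivity)
      ((div_le_one hx).2 ht.2.le) hx.le
    rw [div_mul_cancel₀ _ hx.ne'] at this
    have ht0 := ht.1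
    simp only [zero_add, h.deriv_zero, sub_zero, smul_eq_mul]
    rw [inv_mul_eq_div, le_div_iff₀ ht0]
    calc deriv φ x / x * t = t / x * deriv φ x := by ring
      _ ≤ _ := this
  rwa [div_le_one hx] at h2

lemma slope_le_of_le (h : CostClass φ) {x y z : ℝ} (hx : 0 ≤ x) (hxy : x < y) (hyz : y < z) :
    (deriv φ z - deriv φ y) / (z - y) ≤ (deriv φ y - deriv φ x) / (y - x) :=
  h.concave_deriv.slope_anti_adjacent hx (hx.trans (hxy.trans hyz).le) hxy hyz

lemma deriv_sub_le (h : CostClass φ) {x y : ℝ} (hx : 0 ≤ x) (hxy : x ≤ y) :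
    deriv φ y - deriv φ x ≤ y - x := by
  rcases hxy.eq_or_lt with rfl | hxy
  · simp
  rcases hx.eq_or_lt with rfl | hx
  · simpa [h.deriv_zero] using h.deriv_le hxy.le
  have h1 := h.slope_le_of_le le_rfl hx hxy
  rw [h.deriv_zero, sub_zero, sub_zero] at h1
  have h2 : deriv φ x / x ≤ 1 := (div_le_one hx).2 (h.deriv_le hx.le)
  have h3 := h1.trans h2
  rwa [div_le_one (sub_pos.2 hxy)] at h3

lemma abs_deriv_sub_le (h : CostClass φ) (x y : ℝ) : |deriv φ x - deriv φ y| ≤ |x - y| := by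
  wlog hxy : x ≤ y generalizing x y
  · rw [abs_sub_comm, abs_sub_comm x]
    exact this y x (le_of_not_ge hxy)
  have hm := h.deriv_monotone hxy
  rw [abs_sub_comm, abs_sub_comm x, abs_of_nonneg (sub_nonneg.2 hm),
    abs_of_nonneg (sub_nonneg.2 hxy)]
  rcases le_total 0 x with hx | hx
  · exact h.deriv_sub_le hx hxy
  rcases le_total y 0 with hy | hy
  · have := h.deriv_sub_le (neg_nonneg.2 hy) (neg_le_neg hxy)
    rw [h.deriv_neg, h.deriv_neg] at this
    linarith
  · have h1 := h.deriv_le hy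
    have h2 := h.deriv_le (neg_nonneg.2 hx)
    rw [h.deriv_neg] at h2
    linarith

lemma apply_abs (h : CostClass φ) (x : ℝ) : φ |x| = φ x := by
  rcases abs_choice x with hx | hx <;> rw [hx]
  exact h.even x

/-- Comparison of two differentiable functions on `[0, ∞)` through their derivatives. -/
lemma _root_.le_of_hasDerivAt_le {f g f' g' : ℝ → ℝ} (hf : ∀ x, HasDerivAt f (f' x) x)
    (hg : ∀ x, HasDerivAt g (g' x) x) (h0 : f 0 ≤ g 0) (hle : ∀ x, 0 ≤ x → f' x ≤ g' x)
    {x : ℝ} (hx : 0 ≤ x) : f x ≤ g x := by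
  have hd : ∀ y, HasDerivAt (fun y => g y - f y) (g' y - f' y) y := fun y => (hg y).sub (hf y)
  have hm : MonotoneOn (fun y => g y - f y) (Set.Ici 0) := by
    refine monotoneOn_of_deriv_nonneg (convex_Ici 0)
      (fun y _ => (hd y).continuousAt.continuousWithinAt)
      (fun y _ => (hd y).differentiableAt.differentiableWithinAt) (fun y hy => ?_)
    rw [interior_Ici] at hy
    rw [(hd y).deriv]
    exact sub_nonneg.2 (hle y (le_of_lt hy))
  have := hm (Set.mem_Ici.2 le_rfl) hx hx
  simp only at this
  linarith

lemma nonneg (h : CostClass φ) (x : ℝ) : 0 ≤ φ x := by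
  rw [← h.apply_abs]
  exact le_of_hasDerivAt_le (f := fun _ => 0) (fun y => hasDerivAt_const y 0) h.hasDerivAt
    h.zero.ge (fun y hy => h.deriv_nonneg hy) (abs_nonneg x)

lemma le_sq_div_two (h : CostClass φ) (x : ℝ) : φ x ≤ x ^ 2 / 2 := by
  rw [← h.apply_abs, ← sq_abs]
  refine le_of_hasDerivAt_le (g := fun y => y ^ 2 / 2) (g' := fun y => y) h.hasDerivAt
    (fun y => ?_) (by simp [h.zero]) (fun y hy => h.deriv_le hy) (abs_nonneg x)
  simpa using (hasDerivAt_pow 2 y).div_const 2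

/-- Integrated form of `mul_deriv_le`: `φ x / x²` is nonincreasing on the positive half-line. -/
lemma sq_mul_le (h : CostClass φ) {l : ℝ} (hl : 0 ≤ l) (hl1 : l ≤ 1) (x : ℝ) :
    l ^ 2 * φ x ≤ φ (l * x) := by
  rw [← h.apply_abs x, ← h.apply_abs (l * x), abs_mul, abs_of_nonneg hl]
  refine le_of_hasDerivAt_le (f := fun y => l ^ 2 * φ y) (g := fun y => φ (l * y))
    (f' := fun y => l ^ 2 * deriv φ y) (g' := fun y => deriv φ (l * y) * l)
    (fun y => (h.hasDerivAt y).const_mul _) (fun y => ?_) (by simp [h.zero])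
    (fun y hy => ?_) (abs_nonneg x)
  · have := (h.hasDerivAt (l * y)).comp y ((hasDerivAt_id y).const_mul l)
    rw [mul_one] at this
    exact this
  · have := mul_le_mul_of_nonneg_left (h.mul_deriv_le hl hl1 hy) hl
    linarith

lemma le_four_mul (h : CostClass φ) (x : ℝ) : φ x ≤ 4 * φ (x / 2) := by
  have := h.sq_mul_le (l := 1 / 2) (by norm_num) (by norm_num) x
  rw [show 1 / 2 * x = x / 2 by ring] at this
  linarith

lemma monotoneOn (h : CostClass φ) : MonotoneOn φ (Set.Ici 0) := by
  refine monotoneOn_of_deriv_nonneg (convex_Ici 0) h.contDiff.continuous.continuousOn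
      (fun y _ => (h.differentiable y).differentiableWithinAt) (fun y hy => ?_)
  rw [interior_Ici] at hy
  exact h.deriv_nonneg (le_of_lt hy)

/-- A function `h` on the half-line with `h x / x` nonincreasing is subadditive; by `sq_mul_le` this
applies to `√φ`. This is what makes `W_φ` a distance. -/
lemma sqrt_add_le (h : CostClass φ) (x y : ℝ) : √(φ (x + y)) ≤ √(φ x) + √(φ y) := by
  have key : ∀ {z w : ℝ}, 0 ≤ z → z ≤ w → z / w * √(φ w) ≤ √(φ z) := by
    intro z w hz hzw
    rcases hz.eq_or_lt with rfl | hz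
    · simp
    have hw := hz.trans_le hzw
    have h1 := h.sq_mul_le (l := z / w) (by positivity) ((div_le_one hw).2 hzw) w
    rw [div_mul_cancel₀ _ hw.ne'] at h1
    have h2 := Real.sqrt_le_sqrt h1
    rwa [Real.sqrt_mul (sq_nonneg _), Real.sqrt_sq (by positivity)] at h2
  rw [← h.apply_abs (x + y), ← h.apply_abs x, ← h.apply_abs y]
  have h1 : √(φ |x + y|) ≤ √(φ (|x| + |y|)) :=
    Real.sqrt_le_sqrt (h.monotoneOn (Set.mem_Ici.2 (abs_nonneg _))
      (Set.mem_Ici.2 (add_nonneg (abs_nonneg x) (abs_nonneg y)))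
      (abs_add_le x y))
  refine h1.trans ?_
  rcases (add_nonneg (abs_nonneg x) (abs_nonneg y)).eq_or_lt with h0 | h0
  · rw [← h0]
    simp [h.zero]
    positivity
  · have hx := key (abs_nonneg x) (le_add_of_nonneg_right (abs_nonneg y))
    have hy := key (abs_nonneg y) (le_add_of_nonneg_left (abs_nonneg x))
    calc √(φ (|x| + |y|))
        = |x| / (|x| + |y|) * √(φ (|x| + |y|)) + |y| / (|x| + |y|) * √(φ (|x| + |y|)) := by
          field_simp
      _ ≤ _ := add_le_add hx hy

/-- By convexity the tangent slope at `x / 4` is at most the chord slope over `[x / 4, x]`. It turns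
the moment condition on `X² φ(|X|)` into the one appearing in the bound. -/
lemma mul_deriv_div_four_le (h : CostClass φ) {x : ℝ} (hx : 0 ≤ x) :
    x * deriv φ (x / 4) ≤ 4 / 3 * φ x := by
  rcases hx.eq_or_lt with rfl | hx
  · simp [h.zero]
  have h1 := h.convex.deriv_le_slope (Set.mem_univ (x / 4)) (Set.mem_univ x) (by linarith)
    (h.differentiable _)
  rw [slope_def_field, le_div_iff₀ (by linarith)] at h1
  have := h.nonneg (x / 4)
  linarith

/-- A supergradient of `φ'` at a positive point. -/
lemma exists_supergradient (h : CostClass φ) {a : ℝ} (ha : 0 < a) :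
    ∃ m, 0 ≤ m ∧ ∀ t, 0 ≤ t → deriv φ t ≤ deriv φ a + m * (t - a) := by
  -- Slopes of `φ'` between `t < a` and `a`; they decrease as `t` increases, so their infimum plays
  -- the role of the left derivative at `a`.
  set S := (fun t => (deriv φ a - deriv φ t) / (a - t)) '' Set.Ico 0 a
  have hne : S.Nonempty := ⟨_, 0, ⟨le_rfl, ha⟩, rfl⟩
  have hS0 : ∀ s ∈ S, 0 ≤ s := by
    rintro _ ⟨t, ht, rfl⟩
    exact div_nonneg (sub_nonneg.2 (h.deriv_monotone ht.2.le)) (sub_nonneg.2 ht.2.le)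
  refine ⟨sInf S, le_csInf hne hS0, fun t ht => ?_⟩
  rcases lt_trichotomy t a with hta | rfl | hta
  · have := csInf_le ⟨0, hS0⟩ (⟨t, ⟨ht, hta⟩, rfl⟩ : (deriv φ a - deriv φ t) / (a - t) ∈ S)
    rw [le_div_iff₀ (sub_pos.2 hta)] at this
    linarith
  · simp
  · have : (deriv φ t - deriv φ a) / (t - a) ≤ sInf S := by
      refine le_csInf hne ?_
      rintro _ ⟨s, hs, rfl⟩
      exact h.slope_le_of_le hs.1 hs.2 hta
    rw [div_le_iff₀ (sub_pos.2 hta)] at this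
    linarith

/-- Splitting of `φ'` into a bounded part and a part with a small Lipschitz constant. -/
lemma exists_split (h : CostClass φ) {a : ℝ} (ha : 0 < a) :
    ∃ m, ∃ q : ℝ → ℝ, 0 ≤ m ∧ a * m ≤ deriv φ a ∧ Continuous q ∧
      (∀ t, |q t| ≤ deriv φ a - a * m) ∧
      ∀ s t, |(deriv φ s - q s) - (deriv φ t - q t)| ≤ m * |s - t| := by
  obtain ⟨m, hm0, hm⟩ := h.exists_supergradient ha
  have hma : a * m ≤ deriv φ a := by
    have := hm 0 le_rfl
    rw [h.deriv_zero] at this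
    linarith
  -- Clamping to `[-a, a]`. With `q = φ' ∘ c - m c`, the difference `φ' - q` equals `m t` on `[-a,
  -- a]`, and outside it moves as `φ'` does, whose slopes there are at most `m`.
  set c : ℝ → ℝ := fun t => max (-a) (min t a)
  have hc1 : ∀ t, -a ≤ c t := fun t => le_max_left _ _
  have hc2 : ∀ t, c t ≤ a := fun t => max_le (by linarith) (min_le_right _ _)
  have hcc : Continuous c := by fun_prop
  have hb0 : ∀ t, 0 ≤ t → t ≤ a → 0 ≤ deriv φ t - m * t ∧
      deriv φ t - m * t ≤ deriv φ a - a * m := by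
    intro t ht hta
    have h1 := h.mul_deriv_le (l := t / a) (by positivity) ((div_le_one ha).2 hta) ha.le
    rw [div_mul_cancel₀ _ ha.ne'] at h1
    have h2 : t / a * (a * m) ≤ t / a * deriv φ a :=
      mul_le_mul_of_nonneg_left hma (by positivity)
    have h3 : t / a * (a * m) = m * t := by field_simp
    have h4 := hm t ht
    constructor <;> linarith
  refine ⟨m, fun t => deriv φ (c t) - m * c t, hm0, hma,
    (h.continuous_deriv.comp hcc).sub (continuous_const.mul hcc), fun t => ?_, fun s t => ?_⟩
  · rcases le_total 0 (c t) with h0 | h0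
    · obtain ⟨h1, h2⟩ := hb0 (c t) h0 (hc2 t)
      rw [abs_of_nonneg h1]
      exact h2
    · obtain ⟨h1, h2⟩ := hb0 (-c t) (by linarith) (by linarith [hc1 t])
      rw [h.deriv_neg] at h1 h2
      rw [abs_of_nonpos (by linarith)]
      linarith
  · have hr : ∀ x y, a ≤ x → x ≤ y → deriv φ y - deriv φ x ≤ m * (y - x) := by
      intro x y hx hxy
      rcases hxy.eq_or_lt with rfl | hxy
      · simp
      rcases hx.eq_or_lt with rfl | hx
      · have := hm y (by linarith)
        linarith
      · have h1 := h.slope_le_of_le ha.le hx hxy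
        have h2 : (deriv φ x - deriv φ a) / (x - a) ≤ m := by
          rw [div_le_iff₀ (sub_pos.2 hx)]
          have := hm x (by linarith)
          linarith
        have h3 := h1.trans h2
        rwa [div_le_iff₀ (sub_pos.2 hxy)] at h3
    have key : ∀ x y, x ≤ y → 0 ≤ (deriv φ y - (deriv φ (c y) - m * c y)) -
        (deriv φ x - (deriv φ (c x) - m * c x)) ∧ (deriv φ y - (deriv φ (c y) - m * c y)) -
        (deriv φ x - (deriv φ (c x) - m * c x)) ≤ m * (y - x) := by
      have hval : ∀ x, (x ≤ -a ∧ c x = -a) ∨ (-a ≤ x ∧ x ≤ a ∧ c x = x) ∨ (a ≤ x ∧ c x = a) := by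
        intro x
        rcases le_total x (-a) with h1 | h1
        · exact Or.inl ⟨h1, by simp only [c]; rw [min_eq_left (by linarith), max_eq_left h1]⟩
        rcases le_total x a with h2 | h2
        · exact Or.inr (Or.inl ⟨h1, h2, by
            simp only [c]; rw [min_eq_left (by linarith), max_eq_right h1]⟩)
        · exact Or.inr (Or.inr ⟨h2, by
            simp only [c]; rw [min_eq_right (by linarith), max_eq_right (by linarith)]⟩)
      have hl : ∀ x y, x ≤ y → y ≤ -a → deriv φ y - deriv φ x ≤ m * (y - x) := by
        intro x y hxy hy
        have := hr (-y) (-x) (by linarith) (by linarith)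
        rw [h.deriv_neg, h.deriv_neg] at this
        linarith
      intro x y hxy
      have hmxy : 0 ≤ m * (y - x) := mul_nonneg hm0 (sub_nonneg.2 hxy)
      have hmon := h.deriv_monotone hxy
      rcases hval x with ⟨hx, ex⟩ | ⟨hx, hx', ex⟩ | ⟨hx, ex⟩ <;>
      rcases hval y with ⟨hy, ey⟩ | ⟨hy, hy', ey⟩ | ⟨hy, ey⟩ <;> rw [ex, ey]
      · have := hl x y hxy hy
        constructor <;> linarith
      · have h1 := hl x (-a) hx le_rfl
        have h2 := h.deriv_monotone hx
        have h3 := mul_nonneg hm0 (sub_nonneg.2 hy)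
        constructor <;> linarith
      · have h1 := hl x (-a) hx le_rfl
        have h2 := h.deriv_monotone hx
        have h3 := hr a y le_rfl hy
        have h4 := h.deriv_monotone hy
        have h5 := mul_nonneg hm0 ha.le
        constructor <;> linarith
      · have hx1 : x = -a := by linarith
        have hy1 : y = -a := by linarith
        rw [hx1, hy1]
        simp
      · constructor <;> linarith
      · have h3 := hr a y le_rfl hy
        have h4 := h.deriv_monotone hy
        have h5 := mul_nonneg hm0 (sub_nonneg.2 hx')
        constructor <;> linarith
      · exfalso; linarith
      · have : x = y := by linarith
        subst this
        have : x = a := by linarith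
        subst this
        constructor <;> linarith
      · have := hr x y hx hxy
        constructor <;> linarith
    rcases le_total s t with hst | hst
    · obtain ⟨h1, h2⟩ := key s t hst
      rw [abs_sub_comm, abs_of_nonneg h1, abs_sub_comm s, abs_of_nonneg (sub_nonneg.2 hst)]
      exact h2
    · obtain ⟨h1, h2⟩ := key t s hst
      rw [abs_of_nonneg h1, abs_of_nonneg (sub_nonneg.2 hst)]
      exact h2

end CostClass

/-! ### Iterated integrals of the normal distribution function. -/

/-- The standard normal density. -/
noncomputable def stdPdf (x : ℝ) : ℝ := gaussianPDFReal 0 1 x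

/-- The standard normal distribution function. -/
noncomputable def stdCdf (x : ℝ) : ℝ := ∫ t in Set.Iic x, stdPdf t

/-- The primitive of `stdCdf` vanishing at `-∞`. -/
noncomputable def stdCdf₁ (x : ℝ) : ℝ := x * stdCdf x + stdPdf x

/-- The primitive of `stdCdf₁` vanishing at `-∞`. -/
noncomputable def stdCdf₂ (x : ℝ) : ℝ := (x * stdCdf₁ x + stdCdf x) / 2

/-- The primitive of `stdCdf₂` vanishing at `-∞`. -/
noncomputable def stdCdf₃ (x : ℝ) : ℝ := (x * stdCdf₂ x + stdCdf₁ x) / 3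

lemma stdPdf_eq (x : ℝ) : stdPdf x = (√(2 * Real.pi))⁻¹ * Real.exp (-x ^ 2 / 2) := by
  simp [stdPdf, gaussianPDFReal]

lemma stdPdf_pos (x : ℝ) : 0 < stdPdf x := gaussianPDFReal_pos 0 1 x one_ne_zero

lemma stdPdf_neg (x : ℝ) : stdPdf (-x) = stdPdf x := by simp [stdPdf_eq]

lemma integrable_stdPdf : Integrable stdPdf := integrable_gaussianPDFReal 0 1

lemma hasDerivAt_stdPdf (x : ℝ) : HasDerivAt stdPdf (-x * stdPdf x) x := by
  have h1 : HasDerivAt (fun x : ℝ => (√(2 * Real.pi))⁻¹ * Real.exp (-x ^ 2 / 2))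
      ((√(2 * Real.pi))⁻¹ * (Real.exp (-x ^ 2 / 2) * (-(2 * x) / 2))) x := by
    have h2 : HasDerivAt (fun x : ℝ => -x ^ 2 / 2) (-(2 * x) / 2) x := by
      simpa using ((hasDerivAt_pow 2 x).neg).div_const 2
    exact (h2.exp).const_mul _
  rw [show stdPdf = fun x : ℝ => (√(2 * Real.pi))⁻¹ * Real.exp (-x ^ 2 / 2) from
    funext stdPdf_eq]
  convert h1 using 1
  ring

lemma continuous_stdPdf : Continuous stdPdf :=
  continuous_iff_continuousAt.2 fun x => (hasDerivAt_stdPdf x).continuousAt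

/-- The derivative of the integral of an integrable continuous function over `(-∞, x]`. -/
lemma hasDerivAt_integral_Iic {f : ℝ → ℝ} (hf : Continuous f)
    (hint : ∀ x, IntegrableOn f (Set.Iic x)) (x : ℝ) :
    HasDerivAt (fun y => ∫ t in Set.Iic y, f t) (f x) x := by
  have h1 : (fun y => ∫ t in Set.Iic y, f t) =
      fun y => (∫ t in Set.Iic (0 : ℝ), f t) + ∫ t in (0 : ℝ)..y, f t := by
    funext y
    rw [← intervalIntegral.integral_Iic_sub_Iic (hint 0) (hint y)]
    ring
  rw [h1]
  exact (intervalIntegral.integral_hasDerivAt_right (hf.intervalIntegrable _ _)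
    hf.aestronglyMeasurable.stronglyMeasurableAtFilter hf.continuousAt).const_add _

lemma hasDerivAt_stdCdf (x : ℝ) : HasDerivAt stdCdf (stdPdf x) x :=
  hasDerivAt_integral_Iic continuous_stdPdf (fun _ => integrable_stdPdf.integrableOn) x

lemma continuous_stdCdf : Continuous stdCdf :=
  continuous_iff_continuousAt.2 fun x => (hasDerivAt_stdCdf x).continuousAt

lemma hasDerivAt_stdCdf₁ (x : ℝ) : HasDerivAt stdCdf₁ (stdCdf x) x := by
  have := ((hasDerivAt_id x).mul (hasDerivAt_stdCdf x)).add (hasDerivAt_stdPdf x)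
  exact this.congr_deriv (by simp)

lemma hasDerivAt_stdCdf₂ (x : ℝ) : HasDerivAt stdCdf₂ (stdCdf₁ x) x := by
  have := (((hasDerivAt_id x).mul (hasDerivAt_stdCdf₁ x)).add (hasDerivAt_stdCdf x)).div_const 2
  exact this.congr_deriv (by simp [stdCdf₁]; ring)

lemma hasDerivAt_stdCdf₃ (x : ℝ) : HasDerivAt stdCdf₃ (stdCdf₂ x) x := by
  have := (((hasDerivAt_id x).mul (hasDerivAt_stdCdf₂ x)).add (hasDerivAt_stdCdf₁ x)).div_const 3
  exact this.congr_deriv (by simp [stdCdf₂]; ring)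

lemma stdCdf_nonneg (x : ℝ) : 0 ≤ stdCdf x :=
  integral_nonneg fun t => (stdPdf_pos t).le

lemma stdCdf_neg (x : ℝ) : stdCdf (-x) = 1 - stdCdf x := by
  have h1 : stdCdf (-x) = ∫ t in Set.Ioi x, stdPdf t := by
    have := integral_comp_neg_Iic (-x) stdPdf
    simp only [stdPdf_neg, neg_neg] at this
    exact this
  have h2 := intervalIntegral.integral_Iic_add_Ioi (b := x) integrable_stdPdf.integrableOn
    integrable_stdPdf.integrableOn
  have h3 : ∫ t, stdPdf t = 1 := integral_gaussianPDFReal_eq_one 0 one_ne_zero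
  rw [h1, ← h3, ← h2, stdCdf]
  ring

lemma tendsto_pow_mul_stdPdf (k : ℕ) : Tendsto (fun x => x ^ k * stdPdf x) atBot (𝓝 0) := by
  have h1 := (tendsto_rpow_abs_mul_exp_neg_mul_sq_cocompact (a := 1 / 2) (by norm_num) k).mono_left
    (atBot_le_cocompact (α := ℝ))
  have h2 := h1.const_mul (√(2 * Real.pi))⁻¹
  rw [mul_zero] at h2
  rw [tendsto_zero_iff_abs_tendsto_zero]
  refine h2.congr fun x => ?_
  rw [Function.comp_apply, abs_mul, abs_pow, abs_of_pos (stdPdf_pos x), stdPdf_eq, Real.rpow_natCast,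
    show -(1 / 2) * x ^ 2 = -x ^ 2 / 2 by ring]
  ring

lemma integrable_pow_mul_stdPdf (k : ℕ) : Integrable (fun x => x ^ k * stdPdf x) := by
  have h1 := integrable_rpow_mul_exp_neg_mul_sq (b := 1 / 2) (by norm_num) (s := k)
    (by have : (0 : ℝ) ≤ k := k.cast_nonneg
        linarith)
  refine (h1.const_mul (√(2 * Real.pi))⁻¹).congr (Eventually.of_forall fun x => ?_)
  simp only [stdPdf_eq, Real.rpow_natCast]
  rw [show -(1 / 2) * x ^ 2 = -x ^ 2 / 2 by ring]
  ring

/-- On `(-∞, -1]` the density is at most `-t * stdPdf t`, which is its own derivative. -/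
lemma stdCdf_le_stdPdf {x : ℝ} (hx : x ≤ -1) : stdCdf x ≤ stdPdf x := by
  have hint : Integrable (fun t => -t * stdPdf t) := by
    simpa using (integrable_pow_mul_stdPdf 1).neg
  have h1 := integral_Iic_of_hasDerivAt_of_tendsto' (a := x) (fun t _ => hasDerivAt_stdPdf t)
    hint.integrableOn (by simpa using tendsto_pow_mul_stdPdf 0)
  rw [sub_zero] at h1
  rw [← h1]
  refine setIntegral_mono_on integrable_stdPdf.integrableOn hint.integrableOn measurableSet_Iic
    fun t ht => ?_
  have : t ≤ -1 := le_trans ht hx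
  nlinarith [stdPdf_pos t]

lemma tendsto_pow_mul_stdCdf (k : ℕ) : Tendsto (fun x => x ^ k * stdCdf x) atBot (𝓝 0) := by
  refine squeeze_zero_norm' (a := fun x => |x ^ k * stdPdf x|) ?_ ?_
  · filter_upwards [eventually_le_atBot (-1)] with x hx
    rw [Real.norm_eq_abs, abs_mul, abs_mul, abs_of_nonneg (stdCdf_nonneg x),
      abs_of_pos (stdPdf_pos x)]
    exact mul_le_mul_of_nonneg_left (stdCdf_le_stdPdf hx) (abs_nonneg _)
  · exact (tendsto_zero_iff_abs_tendsto_zero _).1 (tendsto_pow_mul_stdPdf k)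

lemma tendsto_pow_mul_stdCdf₁ (k : ℕ) : Tendsto (fun x => x ^ k * stdCdf₁ x) atBot (𝓝 0) := by
  have := (tendsto_pow_mul_stdCdf (k + 1)).add (tendsto_pow_mul_stdPdf k)
  rw [add_zero] at this
  exact this.congr fun x => by simp only [stdCdf₁]; ring

lemma tendsto_pow_mul_stdCdf₂ (k : ℕ) : Tendsto (fun x => x ^ k * stdCdf₂ x) atBot (𝓝 0) := by
  have := ((tendsto_pow_mul_stdCdf₁ (k + 1)).add (tendsto_pow_mul_stdCdf k)).div_const 2
  rw [add_zero, zero_div] at this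
  exact this.congr fun x => by simp only [stdCdf₂]; ring

lemma tendsto_pow_mul_stdCdf₃ (k : ℕ) : Tendsto (fun x => x ^ k * stdCdf₃ x) atBot (𝓝 0) := by
  have := ((tendsto_pow_mul_stdCdf₂ (k + 1)).add (tendsto_pow_mul_stdCdf₁ k)).div_const 3
  rw [add_zero, zero_div] at this
  exact this.congr fun x => by simp only [stdCdf₃]; ring

lemma nonneg_of_hasDerivAt_of_tendsto_atBot {f f' : ℝ → ℝ} (hf : ∀ x, HasDerivAt f (f' x) x)
    (hf' : ∀ x, 0 ≤ f' x) (hlim : Tendsto f atBot (𝓝 0)) (x : ℝ) : 0 ≤ f x := by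
  have : Monotone f := monotone_of_deriv_nonneg (fun x => (hf x).differentiableAt)
    fun x => by rw [(hf x).deriv]; exact hf' x
  exact this.le_of_tendsto hlim x

lemma stdCdf₁_nonneg (x : ℝ) : 0 ≤ stdCdf₁ x :=
  nonneg_of_hasDerivAt_of_tendsto_atBot hasDerivAt_stdCdf₁ stdCdf_nonneg
    (by simpa using tendsto_pow_mul_stdCdf₁ 0) x

lemma stdCdf₂_nonneg (x : ℝ) : 0 ≤ stdCdf₂ x :=
  nonneg_of_hasDerivAt_of_tendsto_atBot hasDerivAt_stdCdf₂ stdCdf₁_nonneg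
    (by simpa using tendsto_pow_mul_stdCdf₂ 0) x

lemma stdCdf₃_nonneg (x : ℝ) : 0 ≤ stdCdf₃ x :=
  nonneg_of_hasDerivAt_of_tendsto_atBot hasDerivAt_stdCdf₃ stdCdf₂_nonneg
    (by simpa using tendsto_pow_mul_stdCdf₃ 0) x

/-- The derivative is `stdCdf₁ / stdPdf`. On each half-line `(-∞, x]` this dominates the
distribution function by a multiple of the density, hence gives integrability against functions of
linear growth. -/
lemma monotone_stdCdf_div_stdPdf : Monotone fun x => stdCdf x / stdPdf x := by
  have hd : ∀ x, HasDerivAt (fun x => stdCdf x / stdPdf x) (stdCdf₁ x / stdPdf x) x := by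
    intro x
    refine ((hasDerivAt_stdCdf x).div (hasDerivAt_stdPdf x) (stdPdf_pos x).ne').congr_deriv ?_
    have := (stdPdf_pos x).ne'
    simp only [stdCdf₁]
    field_simp
    ring
  exact monotone_of_deriv_nonneg (fun x => (hd x).differentiableAt)
    fun x => by rw [(hd x).deriv]; exact div_nonneg (stdCdf₁_nonneg x) (stdPdf_pos x).le

/-! ### Integrals weighted with the normal distribution function. -/

/-- Functions of at most linear growth. -/
def LinearGrowth (p : ℝ → ℝ) : Prop := ∃ C, 0 ≤ C ∧ ∀ x, |p x| ≤ C * (1 + |x|)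

lemma LinearGrowth.comp_neg {p : ℝ → ℝ} (h : LinearGrowth p) : LinearGrowth fun x => p (-x) := by
  obtain ⟨C, hC, h⟩ := h
  exact ⟨C, hC, fun x => by simpa using h (-x)⟩

lemma LinearGrowth.of_bounded {p : ℝ → ℝ} {A : ℝ} (h : ∀ x, |p x| ≤ A) : LinearGrowth p := by
  have hA : 0 ≤ A := (abs_nonneg _).trans (h 0)
  refine ⟨A, hA, fun x => (h x).trans ?_⟩
  nlinarith [abs_nonneg x]

lemma LinearGrowth.of_lipschitz {p : ℝ → ℝ} {B : ℝ} (h : ∀ x y, |p x - p y| ≤ B * |x - y|) :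
    LinearGrowth p := by
  have hB : 0 ≤ B := by simpa using (abs_nonneg _).trans (h 1 0)
  refine ⟨|p 0| + B, by positivity, fun x => ?_⟩
  have h1 := h x 0
  rw [sub_zero] at h1
  have h2 : |p x| ≤ |p x - p 0| + |p 0| := by simpa using abs_add_le (p x - p 0) (p 0)
  nlinarith [abs_nonneg x, abs_nonneg (p 0), mul_nonneg (abs_nonneg x) (abs_nonneg (p 0))]

lemma LinearGrowth.integrableOn {p : ℝ → ℝ} (h : LinearGrowth p) (hp : Continuous p) (x : ℝ) :
    IntegrableOn (fun t => stdCdf t * p t) (Set.Iic x) := by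
  obtain ⟨C, hC, h⟩ := h
  set M := stdCdf x / stdPdf x
  have hM : 0 ≤ M := div_nonneg (stdCdf_nonneg x) (stdPdf_pos x).le
  have hint : Integrable (fun t => M * C * (stdPdf t + |t * stdPdf t|)) :=
    (integrable_stdPdf.add (by simpa using (integrable_pow_mul_stdPdf 1).abs)).const_mul _
  refine hint.integrableOn.mono' (continuous_stdCdf.mul hp).aestronglyMeasurable.restrict ?_
  refine (ae_restrict_iff' measurableSet_Iic).2 (Eventually.of_forall fun t ht => ?_)
  have h1 : stdCdf t ≤ M * stdPdf t :=
    (div_le_iff₀ (stdPdf_pos t)).1 (monotone_stdCdf_div_stdPdf ht)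
  rw [Real.norm_eq_abs, abs_mul, abs_of_nonneg (stdCdf_nonneg t), abs_mul,
    abs_of_pos (stdPdf_pos t)]
  calc stdCdf t * |p t| ≤ (M * stdPdf t) * (C * (1 + |t|)) :=
        mul_le_mul h1 (h t) (abs_nonneg _) (mul_nonneg hM (stdPdf_pos t).le)
    _ = _ := by ring

/-- The integral of `p` over `(-∞, x]` weighted with the normal distribution function. -/
noncomputable def leftInt (p : ℝ → ℝ) (x : ℝ) : ℝ := ∫ t in Set.Iic x, stdCdf t * p t

/-- The integral of `p` over `[x, ∞)` weighted with the normal tail function. -/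
noncomputable def rightInt (p : ℝ → ℝ) (x : ℝ) : ℝ := leftInt (fun t => p (-t)) (-x)

lemma integrableOn_stdCdf_Iic (x : ℝ) : IntegrableOn stdCdf (Set.Iic x) := by
  simpa using (LinearGrowth.of_bounded (p := fun _ => (1 : ℝ)) (A := 1)
    (by simp)).integrableOn continuous_const x

lemma integral_stdCdf_Iic (x : ℝ) : ∫ t in Set.Iic x, stdCdf t = stdCdf₁ x := by
  have := integral_Iic_of_hasDerivAt_of_tendsto' (a := x) (fun t _ => hasDerivAt_stdCdf₁ t)
    (integrableOn_stdCdf_Iic x) (by simpa using tendsto_pow_mul_stdCdf₁ 0)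
  simpa using this

lemma integrableOn_stdCdf_mul_sub (x : ℝ) :
    IntegrableOn (fun t => stdCdf t * (x - t)) (Set.Iic x) := by
  refine LinearGrowth.integrableOn (LinearGrowth.of_lipschitz (B := 1) fun y z => ?_)
    (by fun_prop) x
  rw [one_mul, abs_sub_comm y z]
  simp

lemma integral_stdCdf_mul_sub_Iic (x : ℝ) :
    ∫ t in Set.Iic x, stdCdf t * (x - t) = stdCdf₂ x := by
  have hd : ∀ t ∈ Set.Iic x, HasDerivAt (fun t => (x - t) * stdCdf₁ t + stdCdf₂ t)
      (stdCdf t * (x - t)) t := by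
    intro t _
    refine ((((hasDerivAt_id t).const_sub x).mul (hasDerivAt_stdCdf₁ t)).add
      (hasDerivAt_stdCdf₂ t)).congr_deriv ?_
    simp
    ring
  have hl : Tendsto (fun t => (x - t) * stdCdf₁ t + stdCdf₂ t) atBot (𝓝 0) := by
    have := (((tendsto_pow_mul_stdCdf₁ 0).const_mul x).sub (tendsto_pow_mul_stdCdf₁ 1)).add
      (tendsto_pow_mul_stdCdf₂ 0)
    simp only [mul_zero, sub_zero, add_zero] at this
    exact this.congr fun t => by ring
  have := integral_Iic_of_hasDerivAt_of_tendsto' hd (integrableOn_stdCdf_mul_sub x) hl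
  simpa using this

lemma hasDerivAt_leftInt {p : ℝ → ℝ} (hp : Continuous p) (h : LinearGrowth p) (x : ℝ) :
    HasDerivAt (leftInt p) (stdCdf x * p x) x :=
  hasDerivAt_integral_Iic (continuous_stdCdf.mul hp) (h.integrableOn hp) x

lemma hasDerivAt_rightInt {p : ℝ → ℝ} (hp : Continuous p) (h : LinearGrowth p) (x : ℝ) :
    HasDerivAt (rightInt p) (-(stdCdf (-x) * p x)) x := by
  have h1 := hasDerivAt_leftInt (hp.comp continuous_neg) h.comp_neg (-x)
  have := h1.comp x (hasDerivAt_neg x)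
  exact this.congr_deriv (by simp)

lemma leftInt_sub {p q : ℝ → ℝ} (hp : Continuous p) (h : LinearGrowth p) (hq : Continuous q)
    (h' : LinearGrowth q) (x : ℝ) :
    leftInt (fun t => p t - q t) x = leftInt p x - leftInt q x := by
  simp only [leftInt, mul_sub]
  exact integral_sub (h.integrableOn hp x) (h'.integrableOn hq x)

lemma rightInt_sub {p q : ℝ → ℝ} (hp : Continuous p) (h : LinearGrowth p) (hq : Continuous q)
    (h' : LinearGrowth q) (x : ℝ) :
    rightInt (fun t => p t - q t) x = rightInt p x - rightInt q x :=
  leftInt_sub (hp.comp continuous_neg) h.comp_neg (hq.comp continuous_neg) h'.comp_neg (-x)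

lemma abs_leftInt_le {p : ℝ → ℝ} {A : ℝ} (hA : ∀ x, |p x| ≤ A) (x : ℝ) :
    |leftInt p x| ≤ A * stdCdf₁ x := by
  rw [← integral_stdCdf_Iic, ← integral_const_mul]
  refine norm_integral_le_of_norm_le (f := fun t => stdCdf t * p t)
    ((integrableOn_stdCdf_Iic x).const_mul A) (Eventually.of_forall fun t => ?_)
  rw [Real.norm_eq_abs, abs_mul, abs_of_nonneg (stdCdf_nonneg t), mul_comm]
  exact mul_le_mul_of_nonneg_right (hA t) (stdCdf_nonneg t)

lemma abs_rightInt_le {p : ℝ → ℝ} {A : ℝ} (hA : ∀ x, |p x| ≤ A) (x : ℝ) :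
    |rightInt p x| ≤ A * stdCdf₁ (-x) :=
  abs_leftInt_le (fun t => hA (-t)) (-x)

/-- Freezing `p` at the endpoint `x` costs `B * (x - t)` under the integral, and the weighted
integral of `x - t` is `stdCdf₂ x`. -/
lemma abs_leftInt_sub_le {p : ℝ → ℝ} {B : ℝ} (hp : Continuous p)
    (hB : ∀ x y, |p x - p y| ≤ B * |x - y|) (x : ℝ) :
    |leftInt p x - p x * stdCdf₁ x| ≤ B * stdCdf₂ x := by
  have h1 : leftInt p x - p x * stdCdf₁ x = ∫ t in Set.Iic x, stdCdf t * (p t - p x) := by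
    simp only [mul_sub]
    rw [integral_sub ((LinearGrowth.of_lipschitz hB).integrableOn hp x)
      ((integrableOn_stdCdf_Iic x).mul_const _), integral_mul_const, integral_stdCdf_Iic, leftInt]
    ring
  rw [h1, ← integral_stdCdf_mul_sub_Iic, ← integral_const_mul]
  refine norm_integral_le_of_norm_le (f := fun t => stdCdf t * (p t - p x))
    ((integrableOn_stdCdf_mul_sub x).const_mul B)
    ((ae_restrict_iff' measurableSet_Iic).2 (Eventually.of_forall fun t ht => ?_))
  rw [Real.norm_eq_abs, abs_mul, abs_of_nonneg (stdCdf_nonneg t)]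
  have h2 := hB t x
  rw [abs_sub_comm t x, abs_of_nonneg (a := x - t) (sub_nonneg.2 ht)] at h2
  nlinarith [mul_le_mul_of_nonneg_left h2 (stdCdf_nonneg t)]

lemma abs_rightInt_sub_le {p : ℝ → ℝ} {B : ℝ} (hp : Continuous p)
    (hB : ∀ x y, |p x - p y| ≤ B * |x - y|) (x : ℝ) :
    |rightInt p x - p x * stdCdf₁ (-x)| ≤ B * stdCdf₂ (-x) := by
  have := abs_leftInt_sub_le (p := fun t => p (-t)) (B := B) (hp.comp continuous_neg)
    (fun y z => (hB _ _).trans_eq (by rw [neg_sub_neg, abs_sub_comm])) (-x)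
  simpa [rightInt] using this

/-! ### The Stein equation for unit variance. -/

/-- The solution `g` of `g'' - x g' - g = p`. -/
noncomputable def steinSol (p : ℝ → ℝ) (x : ℝ) : ℝ :=
  -(stdCdf (-x) * leftInt p x + stdCdf x * rightInt p x) / stdPdf x

/-- The first derivative of `steinSol p`. -/
noncomputable def steinSol₁ (p : ℝ → ℝ) (x : ℝ) : ℝ :=
  (stdCdf₁ (-x) * leftInt p x - stdCdf₁ x * rightInt p x) / stdPdf x

/-- The difference between `p` and the second derivative of `steinSol p`. -/
noncomputable def steinAvg (p : ℝ → ℝ) (x : ℝ) : ℝ :=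
  2 * (stdCdf₂ (-x) * leftInt p x + stdCdf₂ x * rightInt p x) / stdPdf x

/-- This and the next two identities compute the total mass of the kernels in `steinSol`, `steinAvg`
and the derivatives; they are why the estimates below have absolute constants. -/
lemma stdCdf_mul_stdCdf₁ (x : ℝ) :
    stdCdf (-x) * stdCdf₁ x + stdCdf x * stdCdf₁ (-x) = stdPdf x := by
  simp only [stdCdf₁, stdCdf_neg, stdPdf_neg]
  ring

lemma stdCdf₁_mul_stdCdf₂ (x : ℝ) :
    stdCdf₁ (-x) * stdCdf₂ x + stdCdf₁ x * stdCdf₂ (-x) = stdPdf x / 2 := by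
  rw [← stdCdf_mul_stdCdf₁, stdCdf₂, stdCdf₂]
  ring

lemma stdCdf₂_mul_stdCdf₃ (x : ℝ) :
    stdCdf₂ (-x) * stdCdf₃ x + stdCdf₂ x * stdCdf₃ (-x) = stdPdf x / 6 := by
  have := stdCdf₁_mul_stdCdf₂ x
  rw [stdCdf₃, stdCdf₃]
  linear_combination this / 3

lemma hasDerivAt_comp_neg {f : ℝ → ℝ} {f' x : ℝ} (h : HasDerivAt f f' (-x)) :
    HasDerivAt (fun y => f (-y)) (-f') x := by
  have := h.comp x (hasDerivAt_neg x)
  exact this.congr_deriv (by ring)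


lemma hasDerivAt_steinSol {p : ℝ → ℝ} (hp : Continuous p) (h : LinearGrowth p) (x : ℝ) :
    HasDerivAt (steinSol p) (steinSol₁ p x) x := by
  have hL := hasDerivAt_leftInt hp h x
  have hR := hasDerivAt_rightInt hp h x
  refine (((((hasDerivAt_comp_neg (hasDerivAt_stdCdf (-x))).mul hL).add
    ((hasDerivAt_stdCdf x).mul hR)).neg).div (hasDerivAt_stdPdf x)
    (stdPdf_pos x).ne').congr_deriv ?_
  have := (stdPdf_pos x).ne'
  simp only [steinSol₁, stdCdf₁, stdPdf_neg, Pi.neg_apply, Pi.add_apply, Pi.mul_apply]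
  field_simp
  ring

lemma hasDerivAt_steinSol₁ {p : ℝ → ℝ} (hp : Continuous p) (h : LinearGrowth p) (x : ℝ) :
    HasDerivAt (steinSol₁ p) (p x - steinAvg p x) x := by
  have hL := hasDerivAt_leftInt hp h x
  have hR := hasDerivAt_rightInt hp h x
  refine ((((hasDerivAt_comp_neg (hasDerivAt_stdCdf₁ (-x))).mul hL).sub
    ((hasDerivAt_stdCdf₁ x).mul hR)).div (hasDerivAt_stdPdf x)
    (stdPdf_pos x).ne').congr_deriv ?_
  have h0 := (stdPdf_pos x).ne'
  have h1 := stdCdf_mul_stdCdf₁ x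
  simp only [steinAvg, stdCdf₂, Pi.sub_apply, Pi.mul_apply]
  field_simp
  linear_combination p x * h1

lemma hasDerivAt_steinAvg {p : ℝ → ℝ} (hp : Continuous p) (h : LinearGrowth p) (x : ℝ) :
    HasDerivAt (steinAvg p) (6 * (stdCdf₃ x * (rightInt p x - p x * stdCdf₁ (-x)) -
      stdCdf₃ (-x) * (leftInt p x - p x * stdCdf₁ x)) / stdPdf x) x := by
  have hL := hasDerivAt_leftInt hp h x
  have hR := hasDerivAt_rightInt hp h x
  refine (((((hasDerivAt_comp_neg (hasDerivAt_stdCdf₂ (-x))).mul hL).add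
    ((hasDerivAt_stdCdf₂ x).mul hR)).const_mul 2).div (hasDerivAt_stdPdf x)
    (stdPdf_pos x).ne').congr_deriv ?_
  have h0 := (stdPdf_pos x).ne'
  simp only [stdCdf₃, stdCdf₂, Pi.add_apply, Pi.mul_apply]
  field_simp
  ring

lemma steinSol_eq (p : ℝ → ℝ) (x : ℝ) :
    p x - steinAvg p x - x * steinSol₁ p x - steinSol p x = p x := by
  have h0 := (stdPdf_pos x).ne'
  simp only [steinSol, steinSol₁, steinAvg, stdCdf₂]
  field_simp
  ring

lemma continuous_steinAvg {p : ℝ → ℝ} (hp : Continuous p) (h : LinearGrowth p) :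
    Continuous (steinAvg p) :=
  continuous_iff_continuousAt.2 fun x => (hasDerivAt_steinAvg hp h x).continuousAt

lemma steinAvg_sub {p q : ℝ → ℝ} (hp : Continuous p) (h : LinearGrowth p) (hq : Continuous q)
    (h' : LinearGrowth q) (x : ℝ) :
    steinAvg (fun t => p t - q t) x = steinAvg p x - steinAvg q x := by
  simp only [steinAvg, leftInt_sub hp h hq h', rightInt_sub hp h hq h']
  ring

/-- `-steinSol p x` is an average of `p` for a nonnegative kernel, whose mass is `1` by
`stdCdf_mul_stdCdf₁`. The same holds for `steinAvg` by `stdCdf₁_mul_stdCdf₂`. -/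
lemma abs_steinSol_le {p : ℝ → ℝ} {A : ℝ} (hA : ∀ x, |p x| ≤ A) (x : ℝ) :
    |steinSol p x| ≤ A := by
  rw [steinSol, abs_div, abs_neg, abs_of_pos (stdPdf_pos x), div_le_iff₀ (stdPdf_pos x),
    ← stdCdf_mul_stdCdf₁]
  refine (abs_add_le _ _).trans ?_
  rw [abs_mul, abs_mul, abs_of_nonneg (stdCdf_nonneg _), abs_of_nonneg (stdCdf_nonneg _)]
  have h1 := mul_le_mul_of_nonneg_left (abs_leftInt_le hA x) (stdCdf_nonneg (-x))
  have h2 := mul_le_mul_of_nonneg_left (abs_rightInt_le hA x) (stdCdf_nonneg x)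
  linarith

lemma abs_steinAvg_le {p : ℝ → ℝ} {A : ℝ} (hA : ∀ x, |p x| ≤ A) (x : ℝ) :
    |steinAvg p x| ≤ A := by
  have h3 := stdCdf₁_mul_stdCdf₂ x
  rw [steinAvg, abs_div, abs_mul, abs_of_pos (stdPdf_pos x), div_le_iff₀ (stdPdf_pos x),
    abs_of_pos (two_pos (α := ℝ)),
    show stdPdf x = 2 * (stdCdf₁ (-x) * stdCdf₂ x + stdCdf₁ x * stdCdf₂ (-x)) by linarith]
  have h0 := abs_add_le (stdCdf₂ (-x) * leftInt p x) (stdCdf₂ x * rightInt p x)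
  rw [abs_mul, abs_mul, abs_of_nonneg (stdCdf₂_nonneg _), abs_of_nonneg (stdCdf₂_nonneg _)] at h0
  have h1 := mul_le_mul_of_nonneg_left (abs_leftInt_le hA x) (stdCdf₂_nonneg (-x))
  have h2 := mul_le_mul_of_nonneg_left (abs_rightInt_le hA x) (stdCdf₂_nonneg x)
  linarith

/-- The contributions of the constant `p x` to the two integrals cancel, so `p` may be frozen at `x`
and only its oscillation counts. -/
lemma abs_steinSol₁_le {p : ℝ → ℝ} {B : ℝ} (hp : Continuous p)
    (hB : ∀ x y, |p x - p y| ≤ B * |x - y|) (x : ℝ) :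
    |steinSol₁ p x| ≤ B / 2 := by
  have h3 := stdCdf₁_mul_stdCdf₂ x
  have h4 : steinSol₁ p x = (stdCdf₁ (-x) * (leftInt p x - p x * stdCdf₁ x) -
      stdCdf₁ x * (rightInt p x - p x * stdCdf₁ (-x))) / stdPdf x := by
    rw [steinSol₁]
    ring
  rw [h4, abs_div, abs_of_pos (stdPdf_pos x), div_le_iff₀ (stdPdf_pos x),
    show stdPdf x = 2 * (stdCdf₁ (-x) * stdCdf₂ x + stdCdf₁ x * stdCdf₂ (-x)) by linarith]
  refine (abs_sub _ _).trans ?_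
  rw [abs_mul, abs_mul, abs_of_nonneg (stdCdf₁_nonneg _), abs_of_nonneg (stdCdf₁_nonneg _)]
  have h1 := mul_le_mul_of_nonneg_left (abs_leftInt_sub_le hp hB x) (stdCdf₁_nonneg (-x))
  have h2 := mul_le_mul_of_nonneg_left (abs_rightInt_sub_le hp hB x) (stdCdf₁_nonneg x)
  linarith

/-- A function whose derivative is bounded by `B` is `B`-Lipschitz. -/
lemma abs_sub_le_of_hasDerivAt {f f' : ℝ → ℝ} {B : ℝ} (hf : ∀ x, HasDerivAt f (f' x) x)
    (hB : ∀ x, |f' x| ≤ B) (x y : ℝ) : |f x - f y| ≤ B * |x - y| :=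
  convex_univ.norm_image_sub_le_of_norm_hasDerivWithin_le
    (fun z _ => (hf z).hasDerivWithinAt) (fun z _ => hB z) (Set.mem_univ y) (Set.mem_univ x)

lemma abs_steinAvg_sub_le {p : ℝ → ℝ} {B : ℝ} (hp : Continuous p)
    (hB : ∀ x y, |p x - p y| ≤ B * |x - y|) (x y : ℝ) :
    |steinAvg p x - steinAvg p y| ≤ B * |x - y| := by
  refine abs_sub_le_of_hasDerivAt (hasDerivAt_steinAvg hp (LinearGrowth.of_lipschitz hB))
    (fun x => ?_) x y
  -- In the derivative of `steinAvg p` the value `p x` is already subtracted from `p`, so only the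
  -- Lipschitz constant enters; this identity normalises the resulting bound to exactly `B`.
  have h3 := stdCdf₂_mul_stdCdf₃ x
  rw [abs_div, abs_of_pos (stdPdf_pos x), div_le_iff₀ (stdPdf_pos x), abs_mul,
    abs_of_pos (show (0 : ℝ) < 6 by norm_num),
    show stdPdf x = 6 * (stdCdf₂ (-x) * stdCdf₃ x + stdCdf₂ x * stdCdf₃ (-x)) by linarith]
  have h0 := abs_sub (stdCdf₃ x * (rightInt p x - p x * stdCdf₁ (-x)))
    (stdCdf₃ (-x) * (leftInt p x - p x * stdCdf₁ x))
  rw [abs_mul, abs_mul, abs_of_nonneg (stdCdf₃_nonneg _), abs_of_nonneg (stdCdf₃_nonneg _)] at h0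
  have h1 := mul_le_mul_of_nonneg_left (abs_leftInt_sub_le hp hB x) (stdCdf₃_nonneg (-x))
  have h2 := mul_le_mul_of_nonneg_left (abs_rightInt_sub_le hp hB x) (stdCdf₃_nonneg x)
  linarith

/-! ### The Stein equation for variance `v`, by scaling. -/

/-- The solution `g` of `v g'' - x g' - g = p`. -/
noncomputable def gaussSol (v : NNReal) (p : ℝ → ℝ) (x : ℝ) : ℝ :=
  steinSol (fun w => p (√v * w)) (x / √v)

/-- The first derivative of `gaussSol v p`. -/
noncomputable def gaussSol₁ (v : NNReal) (p : ℝ → ℝ) (x : ℝ) : ℝ :=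
  steinSol₁ (fun w => p (√v * w)) (x / √v) / √v

/-- The second derivative of `gaussSol v p`. -/
noncomputable def gaussSol₂ (v : NNReal) (p : ℝ → ℝ) (x : ℝ) : ℝ :=
  (p x - steinAvg (fun w => p (√v * w)) (x / √v)) / v

lemma LinearGrowth.comp_mul {p : ℝ → ℝ} (h : LinearGrowth p) (r : ℝ) :
    LinearGrowth fun w => p (r * w) := by
  obtain ⟨C, hC, h⟩ := h
  refine ⟨C * (1 + |r|), by positivity, fun x => (h _).trans ?_⟩
  rw [mul_assoc, abs_mul]
  refine mul_le_mul_of_nonneg_left ?_ hC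
  nlinarith [abs_nonneg r, abs_nonneg x]

section GaussSol

variable {v : NNReal} {p : ℝ → ℝ}

lemma sqrt_pos_of_ne_zero (hv : v ≠ 0) : 0 < √(v : ℝ) :=
  Real.sqrt_pos.2 (NNReal.coe_pos.2 (pos_iff_ne_zero.2 hv))

lemma hasDerivAt_gaussSol (hp : Continuous p) (h : LinearGrowth p) (x : ℝ) :
    HasDerivAt (gaussSol v p) (gaussSol₁ v p x) x := by
  have := (hasDerivAt_steinSol (hp.comp (continuous_const_mul √v)) (h.comp_mul √v)
    (x / √v)).comp x ((hasDerivAt_id x).div_const √v)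
  exact this.congr_deriv (by simp [gaussSol₁, Function.comp_def, div_eq_mul_inv])

lemma hasDerivAt_gaussSol₁ (hv : v ≠ 0) (hp : Continuous p) (h : LinearGrowth p) (x : ℝ) :
    HasDerivAt (gaussSol₁ v p) (gaussSol₂ v p x) x := by
  have := ((hasDerivAt_steinSol₁ (hp.comp (continuous_const_mul √v)) (h.comp_mul √v)
    (x / √v)).comp x ((hasDerivAt_id x).div_const √v)).div_const √v
  refine this.congr_deriv ?_
  have h1 := (sqrt_pos_of_ne_zero hv).ne'
  rw [mul_one_div, div_div, Real.mul_self_sqrt (NNReal.coe_nonneg v)]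
  simp only [gaussSol₂, Function.comp_def, mul_div_cancel₀ x h1]

lemma gaussSol_eq (hv : v ≠ 0) (p : ℝ → ℝ) (x : ℝ) :
    v * gaussSol₂ v p x - x * gaussSol₁ v p x - gaussSol v p x = p x := by
  have h1 := (sqrt_pos_of_ne_zero hv).ne'
  have h3 : (v : ℝ) ≠ 0 := NNReal.coe_ne_zero.2 hv
  have h2 := steinSol_eq (fun w => p (√v * w)) (x / √v)
  simp only [mul_div_cancel₀ x h1] at h2
  simp only [gaussSol₂, gaussSol₁, gaussSol]
  rw [mul_div_cancel₀ _ h3]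
  linear_combination h2

lemma continuous_gaussSol₂ (hp : Continuous p) (h : LinearGrowth p) :
    Continuous (gaussSol₂ v p) :=
  (hp.sub ((continuous_steinAvg (hp.comp (continuous_const_mul √v)) (h.comp_mul √v)).comp
    (continuous_id.div_const _))).div_const _

lemma gaussSol₂_sub {q : ℝ → ℝ} (hp : Continuous p) (h : LinearGrowth p) (hq : Continuous q)
    (h' : LinearGrowth q) (x : ℝ) :
    gaussSol₂ v (fun t => p t - q t) x = gaussSol₂ v p x - gaussSol₂ v q x := by
  simp only [gaussSol₂]
  rw [steinAvg_sub (p := fun w => p (√v * w)) (q := fun w => q (√v * w))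
    (hp.comp (continuous_const_mul √v)) (h.comp_mul √v)
    (hq.comp (continuous_const_mul √v)) (h'.comp_mul √v)]
  ring

lemma abs_gaussSol_le {A : ℝ} (hA : ∀ x, |p x| ≤ A) (x : ℝ) : |gaussSol v p x| ≤ A :=
  abs_steinSol_le (fun _ => hA _) _

lemma abs_gaussSol₂_le {A : ℝ} (hA : ∀ x, |p x| ≤ A) (x : ℝ) :
    |gaussSol₂ v p x| ≤ 2 * A / v := by
  rw [gaussSol₂, abs_div, NNReal.abs_eq]
  refine div_le_div_of_nonneg_right ((abs_sub _ _).trans ?_) v.2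
  have := abs_steinAvg_le (p := fun w => p (√v * w)) (fun _ => hA _) (x / √v)
  linarith [hA x]

lemma lipschitz_comp_mul {B : ℝ} (hB : ∀ x y, |p x - p y| ≤ B * |x - y|) (x y : ℝ) :
    |p (√v * x) - p (√v * y)| ≤ (B * √v) * |x - y| := by
  refine (hB _ _).trans_eq ?_
  rw [← mul_sub, abs_mul, abs_of_nonneg (Real.sqrt_nonneg _)]
  ring

lemma continuous_of_lipschitz {B : ℝ} (hB : ∀ x y, |p x - p y| ≤ B * |x - y|) : Continuous p := by
  have : LipschitzWith B.toNNReal p := LipschitzWith.of_dist_le_mul fun x y => by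
    rw [Real.dist_eq, Real.dist_eq]
    refine (hB x y).trans ?_
    exact mul_le_mul_of_nonneg_right (Real.le_coe_toNNReal B) (abs_nonneg _)
  exact this.continuous

lemma abs_gaussSol₁_le (hv : v ≠ 0) {B : ℝ} (hB : ∀ x y, |p x - p y| ≤ B * |x - y|) (x : ℝ) :
    |gaussSol₁ v p x| ≤ B / 2 := by
  have h1 := sqrt_pos_of_ne_zero hv
  rw [gaussSol₁, abs_div, abs_of_pos h1, div_le_iff₀ h1]
  refine (abs_steinSol₁_le ((continuous_of_lipschitz hB).comp (continuous_const_mul √v))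
    (lipschitz_comp_mul hB) _).trans_eq ?_
  ring

/-- In `v g'' = p - average of p` both terms have Lipschitz constant `B`, whence the factor `2`. No
smoothness of `p` is needed. -/
lemma abs_gaussSol₂_sub_le (hv : v ≠ 0) {B : ℝ} (hB : ∀ x y, |p x - p y| ≤ B * |x - y|)
    (x y : ℝ) : |gaussSol₂ v p x - gaussSol₂ v p y| ≤ 2 * B / v * |x - y| := by
  have h1 := sqrt_pos_of_ne_zero hv
  have h2 : (0 : ℝ) < v := NNReal.coe_pos.2 (pos_iff_ne_zero.2 hv)
  have h3 := abs_steinAvg_sub_le ((continuous_of_lipschitz hB).comp (continuous_const_mul √v))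
    (lipschitz_comp_mul hB) (x / √v) (y / √v)
  have h4 : B * √v * |x / √v - y / √v| = B * |x - y| := by
    rw [← sub_div, abs_div, abs_of_pos h1]
    field_simp
  rw [h4] at h3
  simp only [gaussSol₂]
  rw [← sub_div, abs_div, abs_of_pos h2, div_le_iff₀ h2]
  have h5 : 2 * B / v * |x - y| * v = B * |x - y| + B * |x - y| := by
    field_simp
    ring
  rw [h5, sub_sub_sub_comm]
  exact (abs_sub _ _).trans (add_le_add (hB x y) h3)

end GaussSol

/-! ### Polynomial growth and Gaussian integration by parts. -/

lemma integrable_one_add_abs_pow_gaussianReal (v : NNReal) (k : ℕ) :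
    Integrable (fun x : ℝ => (1 + |x|) ^ k) (gaussianReal 0 v) := by
  have h0 : MemLp id (k : ℝ≥0∞) (gaussianReal 0 v) := by
    have := memLp_id_gaussianReal (μ := 0) (v := v) (k : NNReal)
    rwa [ENNReal.coe_natCast] at this
  have h1 : MemLp (fun x : ℝ => 1 + |x|) k (gaussianReal 0 v) :=
    (memLp_const (1 : ℝ)).add h0.norm
  refine h1.integrable_norm_pow'.congr (Eventually.of_forall fun x => ?_)
  have h3 : (0 : ℝ) ≤ 1 + |x| := by positivity
  simp only [Real.norm_eq_abs]
  rw [abs_of_nonneg h3]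

/-- Functions of at most polynomial growth. -/
def PolyGrowth (p : ℝ → ℝ) : Prop := ∃ C k, 0 ≤ C ∧ ∀ x, |p x| ≤ C * (1 + |x|) ^ (k : ℕ)

lemma LinearGrowth.polyGrowth {p : ℝ → ℝ} (h : LinearGrowth p) : PolyGrowth p := by
  obtain ⟨C, hC, h⟩ := h
  exact ⟨C, 1, hC, by simpa using h⟩

namespace PolyGrowth

variable {p q : ℝ → ℝ}

lemma mul (hp : PolyGrowth p) (hq : PolyGrowth q) : PolyGrowth fun x => p x * q x := by
  obtain ⟨C, k, hC, hp⟩ := hp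
  obtain ⟨D, l, hD, hq⟩ := hq
  refine ⟨C * D, k + l, by positivity, fun x => ?_⟩
  rw [abs_mul, pow_add]
  refine (mul_le_mul (hp x) (hq x) (abs_nonneg _) (by positivity)).trans_eq ?_
  ring

lemma add (hp : PolyGrowth p) (hq : PolyGrowth q) : PolyGrowth fun x => p x + q x := by
  obtain ⟨C, k, hC, hp⟩ := hp
  obtain ⟨D, l, hD, hq⟩ := hq
  refine ⟨C + D, k + l, by positivity, fun x => (abs_add_le _ _).trans ?_⟩
  have h1 : 1 ≤ 1 + |x| := by linarith [abs_nonneg x]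
  have hk : (1 + |x|) ^ k ≤ (1 + |x|) ^ (k + l) := pow_le_pow_right₀ h1 (by omega)
  have hl : (1 + |x|) ^ l ≤ (1 + |x|) ^ (k + l) := pow_le_pow_right₀ h1 (by omega)
  rw [add_mul]
  exact add_le_add ((hp x).trans (mul_le_mul_of_nonneg_left hk hC))
    ((hq x).trans (mul_le_mul_of_nonneg_left hl hD))

lemma const (c : ℝ) : PolyGrowth fun _ => c := ⟨|c|, 0, abs_nonneg c, by simp⟩

lemma id : PolyGrowth fun x => x := ⟨1, 1, zero_le_one, fun x => by simp⟩

lemma sub (hp : PolyGrowth p) (hq : PolyGrowth q) : PolyGrowth fun x => p x - q x := by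
  simpa [sub_eq_add_neg] using hp.add ((const (-1)).mul hq)

lemma pow (hp : PolyGrowth p) (n : ℕ) : PolyGrowth fun x => p x ^ n := by
  induction n with
  | zero => simpa using const 1
  | succ n ih => simpa [pow_succ] using ih.mul hp

lemma integrable (h : PolyGrowth p) (hp : Continuous p) (v : NNReal) :
    Integrable p (gaussianReal 0 v) := by
  obtain ⟨C, k, -, h⟩ := h
  refine ((integrable_one_add_abs_pow_gaussianReal v k).const_mul C).mono'
    hp.aestronglyMeasurable (Eventually.of_forall fun x => ?_)
  exact h x

end PolyGrowth

/-- Gaussian integration by parts. -/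
lemma integral_id_mul_gaussianReal {v : NNReal} (hv : v ≠ 0) {f f' : ℝ → ℝ}
    (hf : ∀ x, HasDerivAt f (f' x) x) (hf' : Continuous f') (hp : PolyGrowth f)
    (hp' : PolyGrowth f') :
    ∫ x, x * f x ∂gaussianReal 0 v = v * ∫ x, f' x ∂gaussianReal 0 v := by
  have hc : Continuous f := continuous_iff_continuousAt.2 fun x => (hf x).continuousAt
  have hv' : (v : ℝ) ≠ 0 := NNReal.coe_ne_zero.2 hv
  have hd : ∀ x, HasDerivAt (gaussianPDFReal 0 v) (-(x / v) * gaussianPDFReal 0 v x) x := by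
    intro x
    have h2 : HasDerivAt (fun x : ℝ => -(x - 0) ^ 2 / (2 * v)) (-(2 * x) / (2 * v)) x := by
      simpa using ((hasDerivAt_pow 2 x).neg).div_const (2 * (v : ℝ))
    refine ((h2.exp).const_mul (√(2 * Real.pi * v))⁻¹).congr_deriv ?_
    rw [gaussianPDFReal]
    field_simp
  have hint : ∀ g : ℝ → ℝ, Integrable g (gaussianReal 0 v) →
      Integrable (fun x => g x * gaussianPDFReal 0 v x) := by
    intro g hg
    rw [gaussianReal_of_var_ne_zero _ hv] at hg
    have := (integrable_withDensity_iff (measurable_gaussianPDF 0 v)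
      (Eventually.of_forall fun _ => gaussianPDF_lt_top)).1 hg
    simpa [toReal_gaussianPDF] using this
  have hval : ∀ g : ℝ → ℝ, ∫ x, g x ∂gaussianReal 0 v = ∫ x, g x * gaussianPDFReal 0 v x := by
    intro g
    rw [integral_gaussianReal_eq_integral_smul hv]
    simp [mul_comm]
  have h1 := hint _ (hp.integrable hc v)
  have h2 := hint _ (hp'.integrable hf' v)
  have h3 := hint _ ((PolyGrowth.id.mul hp).integrable (continuous_id.mul hc) v)
  have key := integral_mul_deriv_eq_deriv_mul_of_integrable (u := f) (v := gaussianPDFReal 0 v)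
    (u' := f') (v' := fun x => -(x / v) * gaussianPDFReal 0 v x) (fun x _ => hf x)
    (fun x _ => hd x) ((h3.const_mul (-(v : ℝ)⁻¹)).congr (Eventually.of_forall fun x => by
      simp only [Pi.mul_apply]; ring)) h2 h1
  have key' : ∫ x, f x * (-(x / v) * gaussianPDFReal 0 v x) =
      -(v : ℝ)⁻¹ * ∫ x, x * f x * gaussianPDFReal 0 v x := by
    rw [← integral_const_mul]
    congr 1
    funext x
    ring
  rw [key'] at key
  rw [hval, hval]
  field_simp at key
  linarith

/-! ### Stein's identity and the second Hermite coefficient. -/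

/-- The hypotheses under which `gaussSol v p` solves the Stein equation. -/
structure SteinData (v : NNReal) (p : ℝ → ℝ) : Prop where
  ne_zero : v ≠ 0
  cont : Continuous p
  growth : LinearGrowth p
  growth₀ : LinearGrowth (gaussSol v p)
  growth₁ : LinearGrowth (gaussSol₁ v p)

namespace SteinData

variable {v : NNReal} {p : ℝ → ℝ}

/-- Here `g'` is bounded, so `g` has linear growth; for bounded `p` it is `g` and `g''` that are
bounded, so `g'` has linear growth. -/
lemma of_lipschitz (hv : v ≠ 0) {B : ℝ} (hB : ∀ x y, |p x - p y| ≤ B * |x - y|) :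
    SteinData v p where
  ne_zero := hv
  cont := continuous_of_lipschitz hB
  growth := .of_lipschitz hB
  growth₀ := .of_lipschitz (abs_sub_le_of_hasDerivAt (hasDerivAt_gaussSol
    (continuous_of_lipschitz hB) (.of_lipschitz hB)) (abs_gaussSol₁_le hv hB))
  growth₁ := .of_bounded (abs_gaussSol₁_le hv hB)

lemma of_bounded (hv : v ≠ 0) (hp : Continuous p) {A : ℝ} (hA : ∀ x, |p x| ≤ A) :
    SteinData v p where
  ne_zero := hv
  cont := hp
  growth := .of_bounded hA
  growth₀ := .of_bounded (abs_gaussSol_le hA)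
  growth₁ := .of_lipschitz (abs_sub_le_of_hasDerivAt (hasDerivAt_gaussSol₁ hv
    hp (.of_bounded hA)) (abs_gaussSol₂_le hA))

lemma hasDerivAt (h : SteinData v p) (x : ℝ) :
    HasDerivAt (gaussSol v p) (gaussSol₁ v p x) x :=
  hasDerivAt_gaussSol h.cont h.growth x

lemma hasDerivAt₁ (h : SteinData v p) (x : ℝ) :
    HasDerivAt (gaussSol₁ v p) (gaussSol₂ v p x) x :=
  hasDerivAt_gaussSol₁ h.ne_zero h.cont h.growth x

lemma cont₀ (h : SteinData v p) : Continuous (gaussSol v p) :=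
  continuous_iff_continuousAt.2 fun x => (h.hasDerivAt x).continuousAt

lemma cont₁ (h : SteinData v p) : Continuous (gaussSol₁ v p) :=
  continuous_iff_continuousAt.2 fun x => (h.hasDerivAt₁ x).continuousAt

lemma cont₂ (h : SteinData v p) : Continuous (gaussSol₂ v p) :=
  continuous_gaussSol₂ h.cont h.growth

lemma polyGrowth₂ (h : SteinData v p) : PolyGrowth (gaussSol₂ v p) := by
  have h1 := (PolyGrowth.const (v : ℝ)⁻¹).mul ((h.growth.polyGrowth.add
    (PolyGrowth.id.mul h.growth₁.polyGrowth)).add h.growth₀.polyGrowth)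
  have h3 : (v : ℝ) ≠ 0 := NNReal.coe_ne_zero.2 h.ne_zero
  convert h1 using 2 with x
  rw [← gaussSol_eq h.ne_zero p x]
  field_simp
  ring

/-- The Stein equation. -/
lemma eq_sub_integral (h : SteinData v p) {f : ℝ → ℝ} (hf : ∀ x, HasDerivAt f (p x) x)
    (hfg : PolyGrowth f) (x : ℝ) :
    v * gaussSol₁ v p x - x * gaussSol v p x = f x - ∫ y, f y ∂gaussianReal 0 v := by
  have hfc : Continuous f := continuous_iff_continuousAt.2 fun x => (hf x).continuousAt
  have hd : ∀ y, HasDerivAt (fun y => v * gaussSol₁ v p y - y * gaussSol v p y - f y) 0 y := by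
    intro y
    refine ((((h.hasDerivAt₁ y).const_mul (v : ℝ)).sub
      ((hasDerivAt_id y).mul (h.hasDerivAt y))).sub (hf y)).congr_deriv ?_
    have := gaussSol_eq h.ne_zero p y
    simp only [id]
    linear_combination this
  -- The equation solved by `g` is the derivative of the one wanted, so the two sides differ by a
  -- constant; integrating against the Gaussian, where `v g' - x g` has mean zero, identifies it.
  have hconst : ∀ y, v * gaussSol₁ v p y - y * gaussSol v p y - f y =
      v * gaussSol₁ v p x - x * gaussSol v p x - f x := fun y =>
    is_const_of_deriv_eq_zero (fun z => (hd z).differentiableAt) (fun z => (hd z).deriv) y x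
  have hibp := integral_id_mul_gaussianReal h.ne_zero h.hasDerivAt h.cont₁ h.growth₀.polyGrowth
    h.growth₁.polyGrowth
  have h1 := h.growth₁.polyGrowth.integrable h.cont₁ v
  have h2 := (PolyGrowth.id.mul h.growth₀.polyGrowth).integrable (continuous_id.mul h.cont₀) v
  have h3 := hfg.integrable hfc v
  have h4 : ∫ y, (v * gaussSol₁ v p y - y * gaussSol v p y - f y) ∂gaussianReal 0 v =
      v * gaussSol₁ v p x - x * gaussSol v p x - f x := by
    simp only [hconst]
    simp
  have h5 : Integrable (fun y => v * gaussSol₁ v p y - y * gaussSol v p y) (gaussianReal 0 v) :=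
    (h1.const_mul _).sub h2
  rw [integral_sub h5 h3, integral_sub (h1.const_mul _) h2, integral_const_mul, hibp] at h4
  linarith

/-- The second-order Hermite coefficient of `p` through the solution of the Stein equation. -/
lemma integral_hermite (h : SteinData v p) :
    ∫ x, p x * (x ^ 2 / v - 1) ∂gaussianReal 0 v =
      -(3 * v) * ∫ x, gaussSol₂ v p x ∂gaussianReal 0 v := by
  have h0 : (v : ℝ) ≠ 0 := NNReal.coe_ne_zero.2 h.ne_zero
  have c0 := h.cont₀
  have c1 := h.cont₁
  have c2 := h.cont₂
  have g0 := h.growth₀.polyGrowth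
  have g1 := h.growth₁.polyGrowth
  have g2 := h.polyGrowth₂
  have gq : PolyGrowth fun x : ℝ => x ^ 2 / v - 1 := by
    simpa [div_eq_mul_inv] using ((PolyGrowth.id.pow 2).mul (.const (v : ℝ)⁻¹)).sub (.const 1)
  have gl : PolyGrowth fun x : ℝ => 2 * x / v := by
    simpa [div_eq_mul_inv] using ((PolyGrowth.const 2).mul .id).mul (.const (v : ℝ)⁻¹)
  have cq : Continuous fun x : ℝ => x ^ 2 / v - 1 := by fun_prop
  have cl : Continuous fun x : ℝ => 2 * x / v := by fun_prop
  have e1 := integral_id_mul_gaussianReal h.ne_zero (f := fun x => gaussSol₁ v p x * (x ^ 2 / v - 1))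
    (f' := fun x => gaussSol₂ v p x * (x ^ 2 / v - 1) + gaussSol₁ v p x * (2 * x / v))
    (fun x => (h.hasDerivAt₁ x).mul (by
      simpa using (((hasDerivAt_pow 2 x).div_const (v : ℝ)).sub_const 1)))
    ((c2.mul cq).add (c1.mul cl)) (g1.mul gq) ((g2.mul gq).add (g1.mul gl))
  have e2 := integral_id_mul_gaussianReal h.ne_zero h.hasDerivAt₁ c2 g1 g2
  have e3 := integral_id_mul_gaussianReal h.ne_zero (f := fun x => x * gaussSol v p x)
    (f' := fun x => gaussSol v p x + x * gaussSol₁ v p x)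
    (fun x => ((hasDerivAt_id x).mul (h.hasDerivAt x)).congr_deriv (by simp))
    (c0.add (continuous_id.mul c1)) (PolyGrowth.id.mul g0) (g0.add (PolyGrowth.id.mul g1))
  have i1 := (g2.mul gq).integrable (c2.mul cq) v
  have i2 := (PolyGrowth.id.mul g1).integrable (continuous_id.mul c1) v
  have i3 := g0.integrable c0 v
  have i4 := (PolyGrowth.id.mul (g1.mul gq)).integrable (continuous_id.mul (c1.mul cq)) v
  have i5 := (PolyGrowth.id.mul (PolyGrowth.id.mul g0)).integrable
    (continuous_id.mul (continuous_id.mul c0)) v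
  have i6 := (g1.mul gl).integrable (c1.mul cl) v
  rw [integral_add i1 i6] at e1
  rw [integral_add i3 i2] at e3
  have e4 : ∫ x, gaussSol₁ v p x * (2 * x / v) ∂gaussianReal 0 v =
      2 / v * ∫ x, x * gaussSol₁ v p x ∂gaussianReal 0 v := by
    rw [← integral_const_mul]
    congr 1
    funext x
    ring
  have e5 : ∫ x, p x * (x ^ 2 / v - 1) ∂gaussianReal 0 v =
      ∫ x, (v * (gaussSol₂ v p x * (x ^ 2 / v - 1)) - x * (gaussSol₁ v p x * (x ^ 2 / v - 1)) -
        ((v : ℝ)⁻¹ * (x * (x * gaussSol v p x)) - gaussSol v p x)) ∂gaussianReal 0 v := by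
    congr 1
    funext x
    rw [← gaussSol_eq h.ne_zero p x]
    ring
  have i7 : Integrable (fun x => v * (gaussSol₂ v p x * (x ^ 2 / v - 1)) -
      x * (gaussSol₁ v p x * (x ^ 2 / v - 1))) (gaussianReal 0 v) := (i1.const_mul _).sub i4
  have i8 : Integrable (fun x => (v : ℝ)⁻¹ * (x * (x * gaussSol v p x)) - gaussSol v p x)
      (gaussianReal 0 v) := (i5.const_mul _).sub i3
  -- With `H = x² / v - 1`, the terms `v g'' H - x g' H` contribute `-2 E[x g'] = -2 v E g''`, and
  -- `-g H` contributes `-E[x g'] = -v E g''`.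
  rw [e5, integral_sub i7 i8,
    integral_sub (i1.const_mul _) i4, integral_sub (i5.const_mul _) i3, integral_const_mul,
    integral_const_mul, e1, e3, e4, e2]
  field_simp
  ring

end SteinData

/-! ### Quantile coupling on the line. -/

/-- The quantile function of a measure on the real line. -/
noncomputable def quantile (μ : Measure ℝ) (u : ℝ) : ℝ := sInf {x | u ≤ cdf μ x}

/-- Right continuity of the distribution function makes its superlevel set closed on the left. For
`u` outside `(0, 1)` the infimum may be a default value, hence the restriction. -/
lemma quantile_le_iff (μ : Measure ℝ) {u : ℝ} (hu : u ∈ Set.Ioo (0 : ℝ) 1) (x : ℝ) :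
    quantile μ u ≤ x ↔ u ≤ cdf μ x := by
  have hne : {x | u ≤ cdf μ x}.Nonempty :=
    ((tendsto_cdf_atTop μ).eventually (eventually_ge_nhds hu.2)).exists
  have hbdd : BddBelow {x | u ≤ cdf μ x} := by
    obtain ⟨b, hb⟩ := ((tendsto_cdf_atBot μ).eventually (eventually_lt_nhds hu.1)).exists
    exact ⟨b, fun y hy => le_of_lt ((cdf μ).mono.reflect_lt (hb.trans_le hy))⟩
  refine ⟨fun h => ?_, fun h => csInf_le hbdd h⟩
  have h1 : ∀ y, x < y → u ≤ cdf μ y := fun y hy => by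
    obtain ⟨z, hz, hzy⟩ := (csInf_lt_iff hbdd hne).1 (h.trans_lt hy)
    exact le_trans hz ((cdf μ).mono hzy.le)
  have h2 : Tendsto (cdf μ) (𝓝[>] x) (𝓝 (cdf μ x)) :=
    ((cdf μ).right_continuous x).mono_left (nhdsWithin_mono x Set.Ioi_subset_Ici_self)
  exact ge_of_tendsto h2 (eventually_nhdsWithin_of_forall fun y hy => h1 y hy)

lemma quantile_monotoneOn (μ : Measure ℝ) : MonotoneOn (quantile μ) (Set.Ioo 0 1) :=
  fun _ hu _ hw huw => (quantile_le_iff μ hu _).2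
    (huw.trans ((quantile_le_iff μ hw _).1 le_rfl))

lemma aemeasurable_quantile (μ : Measure ℝ) :
    AEMeasurable (quantile μ) (volume.restrict (Set.Ioo (0 : ℝ) 1)) :=
  aemeasurable_restrict_of_monotoneOn measurableSet_Ioo (quantile_monotoneOn μ)

instance : IsProbabilityMeasure (volume.restrict (Set.Ioo (0 : ℝ) 1)) :=
  ⟨by simp⟩

lemma map_quantile (μ : Measure ℝ) [IsProbabilityMeasure μ] :
    (volume.restrict (Set.Ioo (0 : ℝ) 1)).map (quantile μ) = μ := by
  have := Measure.isProbabilityMeasure_map (aemeasurable_quantile μ)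
  refine Measure.ext_of_Iic _ _ fun x => ?_
  rw [Measure.map_apply_of_aemeasurable (aemeasurable_quantile μ) measurableSet_Iic]
  have h1 : volume.restrict (Set.Ioo (0 : ℝ) 1) (quantile μ ⁻¹' Set.Iic x) =
      volume.restrict (Set.Ioo (0 : ℝ) 1) (Set.Iic (cdf μ x)) := by
    refine measure_congr ((ae_restrict_iff' measurableSet_Ioo).2
      (Eventually.of_forall fun u hu => ?_))
    exact propext (quantile_le_iff μ hu x)
  rw [h1, ← ofReal_cdf μ x]
  have h3 := cdf_le_one μ x
  rw [Measure.restrict_congr_set Ioo_ae_eq_Ioc, Measure.restrict_apply measurableSet_Iic,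
    Set.inter_comm, Set.Ioc_inter_Iic, min_eq_right h3, Real.volume_Ioc, sub_zero]

/-! ### Duality bound for the transport cost. -/

/-- Comparison of two functions on `[0, d]` through their derivatives. -/
lemma le_of_hasDerivAt_le_Ioo {f g f' g' : ℝ → ℝ} (hf : ∀ x, HasDerivAt f (f' x) x)
    (hg : ∀ x, HasDerivAt g (g' x) x) (h0 : f 0 ≤ g 0) {d : ℝ} (hd : 0 ≤ d)
    (hle : ∀ x, 0 < x → x < d → f' x ≤ g' x) : f d ≤ g d := by
  have hdd : ∀ y, HasDerivAt (fun y => g y - f y) (g' y - f' y) y := fun y => (hg y).sub (hf y)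
  have hm : MonotoneOn (fun y => g y - f y) (Set.Icc 0 d) := by
    refine monotoneOn_of_deriv_nonneg (convex_Icc 0 d)
      (fun y _ => (hdd y).continuousAt.continuousWithinAt)
      (fun y _ => (hdd y).differentiableAt.differentiableWithinAt) (fun y hy => ?_)
    rw [interior_Icc] at hy
    rw [(hdd y).deriv]
    exact sub_nonneg.2 (hle y hy.1 hy.2)
  have := hm (Set.left_mem_Icc.2 hd) (Set.right_mem_Icc.2 hd) hd
  simp only at this
  linarith

/-- Quadratic growth of a primitive of a function of linear growth. -/
lemma LinearGrowth.primitive {p f : ℝ → ℝ} (h : LinearGrowth p)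
    (hf : ∀ x, HasDerivAt f (p x) x) : ∃ C, 0 ≤ C ∧ ∀ x, |f x| ≤ C * (1 + |x|) ^ 2 := by
  obtain ⟨C, hC, h⟩ := h
  refine ⟨|f 0| + C, by positivity, fun x => ?_⟩
  have h1 : ‖f x - f 0‖ ≤ C * (1 + |x|) * ‖x - 0‖ := by
    refine (convex_closedBall (0 : ℝ) |x|).norm_image_sub_le_of_norm_hasDerivWithin_le
      (fun z _ => (hf z).hasDerivWithinAt) (fun z hz => ?_) (by simp) (by simp)
    rw [mem_closedBall_zero_iff, Real.norm_eq_abs] at hz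
    exact (h z).trans (mul_le_mul_of_nonneg_left (by linarith) hC)
  rw [sub_zero, Real.norm_eq_abs, Real.norm_eq_abs] at h1
  have h2 : |f x| ≤ |f x - f 0| + |f 0| := by simpa using abs_add_le (f x - f 0) (f 0)
  have h3 : 0 ≤ |x| := abs_nonneg x
  nlinarith [abs_nonneg (f 0), mul_nonneg hC h3, mul_nonneg (abs_nonneg (f 0)) h3,
    mul_nonneg (abs_nonneg (f 0)) (mul_nonneg h3 h3)]

lemma integrable_of_abs_le_sq {Ω : Type*} [MeasurableSpace Ω] {P : Measure Ω}
    [IsFiniteMeasure P] {T : Ω → ℝ} (hT : MemLp T 2 P) {f : ℝ → ℝ} (hf : Continuous f)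
    {C : ℝ} (h : ∀ x, |f x| ≤ C * (1 + |x|) ^ 2) : Integrable (fun ω => f (T ω)) P := by
  have h1 : MemLp (fun ω => 1 + |T ω|) 2 P := (memLp_const (1 : ℝ)).add hT.norm
  exact (h1.integrable_sq.const_mul C).mono'
    (hf.comp_aestronglyMeasurable hT.aestronglyMeasurable) (Eventually.of_forall fun ω => h _)

namespace CostClass

variable {φ : ℝ → ℝ}

/-- Lower bound for the increment of a primitive of `φ' ∘ s` over an interval on which `s` is at
least the distance to the endpoints. -/
lemma half_le_sub (h : CostClass φ) {s f : ℝ → ℝ}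
    (hf : ∀ x, HasDerivAt f (deriv φ (s x)) x) {a b : ℝ} (hab : a < b)
    (hs : ∀ x ∈ Set.Ioo a b, min (x - a) (b - x) ≤ s x) : φ (b - a) / 2 ≤ f b - f a := by
  set d := (b - a) / 2 with hd
  have hd0 : 0 ≤ d := by linarith
  have h1 : φ d ≤ f (a + d) - f a := by
    refine le_of_hasDerivAt_le_Ioo (g := fun t => f (a + t) - f a) (f' := deriv φ)
      (g' := fun t => deriv φ (s (a + t))) h.hasDerivAt (fun t => ?_) (by simp [h.zero]) hd0
      (fun t ht htd => ?_)
    · exact (HasDerivAt.comp_const_add a t (hf (a + t))).sub_const _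
    · refine h.deriv_monotone (le_trans ?_ (hs (a + t) ⟨by linarith, by linarith⟩))
      exact le_min (by linarith) (by linarith)
  have h2 : φ d ≤ f b - f (b - d) := by
    refine le_of_hasDerivAt_le_Ioo (g := fun t => f b - f (b - t)) (f' := deriv φ)
      (g' := fun t => deriv φ (s (b - t))) h.hasDerivAt (fun t => ?_) (by simp [h.zero]) hd0
      (fun t ht htd => ?_)
    · have := (HasDerivAt.comp_const_sub b t (hf (b - t))).const_sub (f b)
      simpa using this
    · refine h.deriv_monotone (le_trans ?_ (hs (b - t) ⟨by linarith, by linarith⟩))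
      exact le_min (by linarith) (by linarith)
  -- Each half of the interval contributes at least `φ d`, and `2 φ d ≥ φ (2 d) / 2`.
  have h3 := h.le_four_mul (b - a)
  rw [← hd] at h3
  rw [show b - d = a + d by rw [hd]; ring] at h2
  linarith

end CostClass

/-- `s` is the distance to the complement of `A` minus the distance to the complement of `B`.
Disjointness makes at least one of the two vanish at each point. -/
lemma exists_signed_dist {A B : Set ℝ} (hAB : Disjoint A B) (hA : A.Nonempty)
    (hB : B.Nonempty) :
    ∃ s : ℝ → ℝ, (∀ x y, |s x - s y| ≤ |x - y|) ∧
      (∀ a b, Set.Ioo a b ⊆ A → ∀ x ∈ Set.Ioo a b, min (x - a) (b - x) ≤ s x) ∧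
      (∀ a b, Set.Ioo a b ⊆ B → ∀ x ∈ Set.Ioo a b, min (x - a) (b - x) ≤ -s x) := by
  -- Needed because `Metric.infDist` to the empty set is `0` by convention.
  have hA' : Aᶜ.Nonempty := hB.mono (Set.disjoint_right.1 hAB)
  have hB' : Bᶜ.Nonempty := hA.mono (Set.disjoint_left.1 hAB)
  have hz : ∀ x, Metric.infDist x Aᶜ = 0 ∨ Metric.infDist x Bᶜ = 0 := by
    intro x
    by_cases hx : x ∈ A
    · exact Or.inr (Metric.infDist_zero_of_mem (Set.disjoint_left.1 hAB hx))
    · exact Or.inl (Metric.infDist_zero_of_mem hx)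
  have hcross : ∀ x y, 0 < Metric.infDist x Aᶜ → 0 < Metric.infDist y Bᶜ →
      Metric.infDist x Aᶜ + Metric.infDist y Bᶜ ≤ |x - y| := by
    intro x y
    generalize hα : Metric.infDist x Aᶜ = α
    generalize hβ : Metric.infDist y Bᶜ = β
    intro hα0 hβ0
    by_contra! hlt
    rw [abs_sub_comm] at hlt
    have hpos : 0 < α + β := by positivity
    -- The point dividing the segment from `x` to `y` in the ratio `α : β`: if the segment were
    -- shorter than `α + β`, this point would lie in both `A` and `B`.
    have h1 : x + (y - x) * (α / (α + β)) ∉ Aᶜ := by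
      refine Metric.notMem_of_dist_lt_infDist (x := x) ?_
      rw [hα, Real.dist_eq, sub_add_cancel_left, abs_neg, abs_mul,
        abs_of_pos (div_pos hα0 hpos), mul_div_assoc', div_lt_iff₀ hpos, mul_comm]
      exact mul_lt_mul_of_pos_left hlt hα0
    have h2 : x + (y - x) * (α / (α + β)) ∉ Bᶜ := by
      refine Metric.notMem_of_dist_lt_infDist (x := y) ?_
      have : y - (x + (y - x) * (α / (α + β))) = (y - x) * (β / (α + β)) := by
        field_simp
        ring
      rw [hβ, Real.dist_eq, this, abs_mul,
        abs_of_pos (div_pos hβ0 hpos), mul_div_assoc', div_lt_iff₀ hpos, mul_comm]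
      exact mul_lt_mul_of_pos_left hlt hβ0
    exact Set.disjoint_left.1 hAB (not_not.1 h1) (not_not.1 h2)
  have hdist : ∀ {C : Set ℝ} {a b : ℝ}, C.Nonempty → Set.Ioo a b ⊆ Cᶜ → ∀ x ∈ Set.Ioo a b,
      min (x - a) (b - x) ≤ Metric.infDist x C := by
    intro C a b hC hab x hx
    refine (Metric.le_infDist hC).2 fun {y} hy => ?_
    rw [Real.dist_eq]
    by_contra! hlt
    rw [lt_min_iff, abs_lt, abs_lt] at hlt
    exact hab ⟨by linarith [hlt.1.2], by linarith [hlt.2.1]⟩ hy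
  refine ⟨fun x => Metric.infDist x Aᶜ - Metric.infDist x Bᶜ, fun x y => ?_,
    fun a b hab x hx => ?_, fun a b hab x hx => ?_⟩
  · have hA1 := (Metric.lipschitz_infDist_pt Aᶜ).dist_le_mul x y
    have hB1 := (Metric.lipschitz_infDist_pt Bᶜ).dist_le_mul x y
    have c1 := hcross x y
    have c2 := hcross y x
    rw [abs_sub_comm y x] at c2
    rw [NNReal.coe_one, one_mul, Real.dist_eq, Real.dist_eq] at hA1 hB1
    simp only
    have n1 : 0 ≤ Metric.infDist x Aᶜ := Metric.infDist_nonneg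
    have n2 : 0 ≤ Metric.infDist y Aᶜ := Metric.infDist_nonneg
    have n3 : 0 ≤ Metric.infDist x Bᶜ := Metric.infDist_nonneg
    have n4 : 0 ≤ Metric.infDist y Bᶜ := Metric.infDist_nonneg
    have z1 := hz x
    have z2 := hz y
    rw [abs_le] at hA1 hB1 ⊢
    generalize Metric.infDist x Aᶜ = p at *
    generalize Metric.infDist y Aᶜ = q at *
    generalize Metric.infDist x Bᶜ = r at *
    generalize Metric.infDist y Bᶜ = t at *
    rcases z1 with rfl | rfl <;> rcases z2 with rfl | rfl
    · constructor <;> linarith [hB1.1, hB1.2]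
    · rcases n2.eq_or_lt with rfl | n2
      · constructor <;> linarith [hB1.1, hB1.2]
      rcases n3.eq_or_lt with rfl | n3
      · constructor <;> linarith [hA1.1, hA1.2]
      have := c2 n2 n3
      constructor <;> linarith
    · rcases n1.eq_or_lt with rfl | n1
      · constructor <;> linarith [hB1.1, hB1.2]
      rcases n4.eq_or_lt with rfl | n4
      · constructor <;> linarith [hA1.1, hA1.2]
      have := c1 n1 n4
      constructor <;> linarith
    · constructor <;> linarith [hA1.1, hA1.2]
  · have h1 := hdist hA' (by rwa [compl_compl]) x hx
    have h2 : Metric.infDist x Bᶜ = 0 :=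
      Metric.infDist_zero_of_mem (Set.disjoint_left.1 hAB (hab hx))
    simp only [h2, sub_zero]
    exact h1
  · have h1 := hdist hB' (by rwa [compl_compl]) x hx
    have h2 : Metric.infDist x Aᶜ = 0 :=
      Metric.infDist_zero_of_mem (Set.disjoint_right.1 hAB (hab hx))
    simp only [h2, zero_sub, neg_neg]
    exact h1

/-- The transport cost is bounded by the cost of any pair of random variables with the given
laws. -/
lemma transportCost_le_lintegral {Ω : Type*} [MeasurableSpace Ω] {P : Measure Ω} {φ : ℝ → ℝ}
    (hφ : Continuous φ) {Y Z : Ω → ℝ} (hY : AEMeasurable Y P) (hZ : AEMeasurable Z P) :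
    transportCost φ (P.map Y) (P.map Z) ≤ ∫⁻ ω, ENNReal.ofReal (φ (Y ω - Z ω)) ∂P := by
  have hYZ : AEMeasurable (fun ω => (Y ω, Z ω)) P := hY.prodMk hZ
  have hmem : P.map (fun ω => (Y ω, Z ω)) ∈ couplings (P.map Y) (P.map Z) := by
    constructor
    · rw [AEMeasurable.map_map_of_aemeasurable measurable_fst.aemeasurable hYZ]
      rfl
    · rw [AEMeasurable.map_map_of_aemeasurable measurable_snd.aemeasurable hYZ]
      rfl
  refine (iInf₂_le _ hmem).trans_eq ?_
  rw [lintegral_map' _ hYZ]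
  exact (ENNReal.measurable_ofReal.comp
    (hφ.measurable.comp (measurable_fst.sub measurable_snd))).aemeasurable

/-- Duality bound: the transport cost on the line is at most twice the difference of the integrals
of a primitive of `φ' ∘ s`, for some `1`-Lipschitz function `s`. -/
theorem exists_transportCost_le {φ : ℝ → ℝ} (h : CostClass φ) (μ ν : Measure ℝ)
    [IsProbabilityMeasure μ] [IsProbabilityMeasure ν] (hμ : MemLp id 2 μ) (hν : MemLp id 2 ν)
    (hmean : ∫ x, x ∂μ = ∫ x, x ∂ν) :
    ∃ s : ℝ → ℝ, (∀ x y, |s x - s y| ≤ |x - y|) ∧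
      ∀ f : ℝ → ℝ, (∀ x, HasDerivAt f (deriv φ (s x)) x) →
        transportCost φ μ ν ≤ ENNReal.ofReal (2 * (∫ x, f x ∂μ - ∫ x, f x ∂ν)) := by
  set l : Measure ℝ := volume.restrict (Set.Ioo (0 : ℝ) 1)
  set Y := quantile μ
  set Z := quantile ν
  have hYm : AEMeasurable Y l := aemeasurable_quantile μ
  have hZm : AEMeasurable Z l := aemeasurable_quantile ν
  have hYmap : l.map Y = μ := map_quantile μ
  have hZmap : l.map Z = ν := map_quantile ν
  have hcost : transportCost φ μ ν ≤ ∫⁻ u, ENNReal.ofReal (φ (Y u - Z u)) ∂l := by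
    have := transportCost_le_lintegral h.contDiff.continuous hYm hZm
    rwa [hYmap, hZmap] at this
  have hint : ∀ g : ℝ → ℝ, Continuous g → Integrable g μ → Integrable g ν →
      Integrable (fun u => g (Y u)) l ∧ Integrable (fun u => g (Z u)) l ∧
      ∫ u, g (Y u) ∂l = ∫ x, g x ∂μ ∧ ∫ u, g (Z u) ∂l = ∫ x, g x ∂ν := by
    intro g hg hgμ hgν
    rw [← hYmap] at hgμ ⊢
    rw [← hZmap] at hgν ⊢
    exact ⟨hgμ.comp_aemeasurable hYm, hgν.comp_aemeasurable hZm,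
      (integral_map hYm hg.aestronglyMeasurable).symm,
      (integral_map hZm hg.aestronglyMeasurable).symm⟩
  obtain ⟨iY, iZ, eY, eZ⟩ := hint (fun x => x) continuous_id (hμ.integrable one_le_two)
    (hν.integrable one_le_two)
  -- If one of the sets `A`, `B` below is empty, then `Y - Z` has constant sign almost everywhere
  -- and mean zero, hence vanishes and the cost is `0`.
  have hdeg : (∀ᵐ u ∂l, Y u = Z u) → ∃ s : ℝ → ℝ, (∀ x y, |s x - s y| ≤ |x - y|) ∧
      ∀ f : ℝ → ℝ, (∀ x, HasDerivAt f (deriv φ (s x)) x) →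
        transportCost φ μ ν ≤ ENNReal.ofReal (2 * (∫ x, f x ∂μ - ∫ x, f x ∂ν)) := by
    intro hae
    refine ⟨fun _ => 0, fun x y => by simp, fun f _ => hcost.trans (le_of_eq_of_le ?_ zero_le)⟩
    rw [lintegral_congr_ae (g := fun _ => 0)]
    · simp
    · filter_upwards [hae] with u hu
      simp [hu, h.zero]
  set A : Set ℝ := ⋃ u ∈ Set.Ioo (0 : ℝ) 1, Set.Ioo (Z u) (Y u)
  set B : Set ℝ := ⋃ u ∈ Set.Ioo (0 : ℝ) 1, Set.Ioo (Y u) (Z u)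
  have hmem : ∀ᵐ u ∂l, u ∈ Set.Ioo (0 : ℝ) 1 := ae_restrict_mem measurableSet_Ioo
  -- A point in `(Z u, Y u)` and in `(Y w, Z w)` would contradict the monotonicity of `Y` if `u ≤
  -- w`, and that of `Z` if `w ≤ u`.
  have hAB : Disjoint A B := by
    rw [Set.disjoint_left]
    intro x hxA hxB
    simp only [A, B, Set.mem_iUnion, exists_prop] at hxA hxB
    obtain ⟨u, hu, hxu⟩ := hxA
    obtain ⟨w, hw, hxw⟩ := hxB
    rcases le_total u w with huw | huw
    · have := quantile_monotoneOn μ hu hw huw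
      linarith [hxu.2, hxw.1]
    · have := quantile_monotoneOn ν hw hu huw
      linarith [hxu.1, hxw.2]
  have hdiff : ∫ u, (Y u - Z u) ∂l = 0 := by
    rw [integral_sub iY iZ, eY, eZ, hmean, sub_self]
  by_cases hA : A.Nonempty
  swap
  · refine hdeg ?_
    have h0 : ∀ᵐ u ∂l, 0 ≤ Z u - Y u := by
      filter_upwards [hmem] with u hu
      by_contra! hlt
      obtain ⟨x, hx⟩ := exists_between (sub_neg.1 hlt)
      exact hA ⟨x, Set.mem_biUnion hu hx⟩
    have h1 : ∫ u, (Z u - Y u) ∂l = 0 := by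
      rw [← neg_zero, ← hdiff, ← integral_neg]
      simp
    filter_upwards [(integral_eq_zero_iff_of_nonneg_ae h0 (iZ.sub iY)).1 h1] with u hu
    have : Z u - Y u = 0 := hu
    linarith
  by_cases hB : B.Nonempty
  swap
  · refine hdeg ?_
    have h0 : ∀ᵐ u ∂l, 0 ≤ Y u - Z u := by
      filter_upwards [hmem] with u hu
      by_contra! hlt
      obtain ⟨x, hx⟩ := exists_between (sub_neg.1 hlt)
      exact hB ⟨x, Set.mem_biUnion hu hx⟩
    filter_upwards [(integral_eq_zero_iff_of_nonneg_ae h0 (iY.sub iZ)).1 hdiff] with u hu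
    have : Y u - Z u = 0 := hu
    linarith
  obtain ⟨s, hs, hsA, hsB⟩ := exists_signed_dist hAB hA hB
  refine ⟨s, hs, fun f hf => hcost.trans ?_⟩
  have hfc : Continuous f := continuous_iff_continuousAt.2 fun x => (hf x).continuousAt
  have hp : LinearGrowth fun x => deriv φ (s x) := LinearGrowth.of_lipschitz (B := 1)
    fun x y => by rw [one_mul]; exact (h.abs_deriv_sub_le _ _).trans (hs x y)
  obtain ⟨C, hC, hfC⟩ := hp.primitive hf
  obtain ⟨jY, jZ, fY, fZ⟩ := hint f hfc (integrable_of_abs_le_sq hμ hfc hfC)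
    (integrable_of_abs_le_sq hν hfc hfC)
  have key : ∀ u ∈ Set.Ioo (0 : ℝ) 1, φ (Y u - Z u) ≤ 2 * (f (Y u) - f (Z u)) := by
    intro u hu
    rcases lt_trichotomy (Y u) (Z u) with hlt | heq | hlt
    · have := h.half_le_sub (s := fun x => -s x) (f := fun x => -f x)
        (fun x => by rw [h.deriv_neg]; exact (hf x).neg) hlt
        (hsB _ _ (Set.subset_biUnion_of_mem (u := fun u => Set.Ioo (Y u) (Z u)) hu))
      rw [← h.even, neg_sub] at this
      linarith
    · simp [heq, h.zero]
    · have := h.half_le_sub hf hlt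
        (hsA _ _ (Set.subset_biUnion_of_mem (u := fun u => Set.Ioo (Z u) (Y u)) hu))
      linarith
  have hnn : ∀ᵐ u ∂l, 0 ≤ 2 * (f (Y u) - f (Z u)) := by
    filter_upwards [hmem] with u hu
    exact (h.nonneg _).trans (key u hu)
  have hval : 2 * (∫ x, f x ∂μ - ∫ x, f x ∂ν) = ∫ u, 2 * (f (Y u) - f (Z u)) ∂l := by
    rw [integral_const_mul, integral_sub jY jZ, fY, fZ]
  have hi : Integrable (fun u => 2 * (f (Y u) - f (Z u))) l := (jY.sub jZ).const_mul 2
  rw [hval, ofReal_integral_eq_lintegral_ofReal hi hnn]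
  refine lintegral_mono_ae ?_
  filter_upwards [hmem] with u hu
  exact ENNReal.ofReal_le_ofReal (key u hu)

/-! ### Taylor estimates. -/

/-- A function vanishing at `0` is controlled by a primitive of a bound for its derivative. -/
lemma abs_le_of_abs_hasDerivAt_le {H H' G G' : ℝ → ℝ} (hH : ∀ x, HasDerivAt H (H' x) x)
    (hG : ∀ x, HasDerivAt G (G' x) x) (hH0 : H 0 = 0) (hG0 : G 0 = 0)
    (hle : ∀ x, |H' x| ≤ G' |x|) (x : ℝ) : |H x| ≤ G |x| := by
  have pos : ∀ {F F' : ℝ → ℝ}, (∀ x, HasDerivAt F (F' x) x) → F 0 = 0 →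
      (∀ x, |F' x| ≤ G' |x|) → ∀ {x : ℝ}, 0 ≤ x → |F x| ≤ G x := by
    intro F F' hF hF0 hle x hx
    have hle' : ∀ y, 0 ≤ y → |F' y| ≤ G' y := fun y hy => by
      simpa [abs_of_nonneg hy] using hle y
    rw [abs_le]
    constructor
    · rw [neg_le]
      exact le_of_hasDerivAt_le (fun y => (hF y).neg) hG (by simp [hF0, hG0])
        (fun y hy => (neg_le_abs _).trans (hle' y hy)) hx
    · exact le_of_hasDerivAt_le hF hG (by simp [hF0, hG0])
        (fun y hy => (le_abs_self _).trans (hle' y hy)) hx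
  rcases le_total 0 x with hx | hx
  · rw [abs_of_nonneg hx]
    exact pos hH hH0 hle hx
  · rw [abs_of_nonpos hx]
    have := pos (F := fun y => H (-y)) (F' := fun y => -H' (-y))
      (fun y => hasDerivAt_comp_neg (hH (-y))) (by simpa using hH0)
      (fun y => by simpa using hle (-y)) (neg_nonneg.2 hx)
    simpa using this

section Taylor

variable {g g₁ g₂ : ℝ → ℝ} (t : ℝ)

lemma abs_taylor_one_le (hg : ∀ x, HasDerivAt g (g₁ x) x) {D : ℝ}
    (hD : ∀ x, |g₁ (t + x) - g₁ t| ≤ D * |x|) (x : ℝ) :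
    |g (t + x) - g t - x * g₁ t| ≤ D * x ^ 2 / 2 := by
  have := abs_le_of_abs_hasDerivAt_le (H := fun x => g (t + x) - g t - x * g₁ t)
    (H' := fun x => g₁ (t + x) - g₁ t) (G := fun x => D * x ^ 2 / 2) (G' := fun x => D * x)
    (fun y => ?_) (fun y => ?_) (by simp) (by simp) hD x
  · simpa using this
  · exact (((HasDerivAt.comp_const_add t y (hg (t + y))).sub_const _).sub
      ((hasDerivAt_id y).mul_const (g₁ t))).congr_deriv (by simp)
  · exact (((hasDerivAt_pow 2 y).const_mul D).div_const 2).congr_deriv (by simp; ring)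

lemma abs_taylor_two_le (hg : ∀ x, HasDerivAt g (g₁ x) x) (hg₁ : ∀ x, HasDerivAt g₁ (g₂ x) x)
    {α β : ℝ} (hD : ∀ x, |g₂ (t + x) - g₂ t| ≤ α + β * |x|) (x : ℝ) :
    |g (t + x) - g t - x * g₁ t - x ^ 2 / 2 * g₂ t| ≤ α * x ^ 2 / 2 + β * |x| ^ 3 / 6 := by
  have h1 : ∀ x, |g₁ (t + x) - g₁ t - x * g₂ t| ≤ α * |x| + β * |x| ^ 2 / 2 := by
    refine abs_le_of_abs_hasDerivAt_le (H' := fun x => g₂ (t + x) - g₂ t)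
      (G := fun x => α * x + β * x ^ 2 / 2) (G' := fun x => α + β * x)
      (fun y => ?_) (fun y => ?_) (by simp) (by simp) hD
    · exact (((HasDerivAt.comp_const_add t y (hg₁ (t + y))).sub_const _).sub
        ((hasDerivAt_id y).mul_const (g₂ t))).congr_deriv (by simp)
    · exact (((hasDerivAt_id y).const_mul α).add
        (((hasDerivAt_pow 2 y).const_mul β).div_const 2)).congr_deriv (by simp; ring)
  have := abs_le_of_abs_hasDerivAt_le
    (H := fun x => g (t + x) - g t - x * g₁ t - x ^ 2 / 2 * g₂ t)
    (H' := fun x => g₁ (t + x) - g₁ t - x * g₂ t)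
    (G := fun x => α * x ^ 2 / 2 + β * x ^ 3 / 6) (G' := fun x => α * x + β * x ^ 2 / 2)
    (fun y => ?_) (fun y => ?_) (by simp) (by simp) h1 x
  · simpa using this
  · exact ((((HasDerivAt.comp_const_add t y (hg (t + y))).sub_const _).sub
      ((hasDerivAt_id y).mul_const (g₁ t))).sub
      (((hasDerivAt_pow 2 y).div_const 2).mul_const (g₂ t))).congr_deriv (by simp)
  · exact ((((hasDerivAt_pow 2 y).const_mul α).div_const 2).add
      (((hasDerivAt_pow 3 y).const_mul β).div_const 6)).congr_deriv (by simp; ring)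

end Taylor

/-! ### Expansion of the Stein operator in one independent summand. -/

section Summand

variable {Ω : Type*} [MeasurableSpace Ω] {P : Measure Ω} {T X : Ω → ℝ}

lemma LinearGrowth.memLp [IsFiniteMeasure P] {f : ℝ → ℝ} (h : LinearGrowth f) (hf : Continuous f) {p : ℝ≥0∞}
    (hT : MemLp T p P) : MemLp (fun ω => f (T ω)) p P := by
  obtain ⟨C, hC, h⟩ := h
  have h1 : MemLp (fun ω => C * (1 + |T ω|)) p P := ((memLp_const (1 : ℝ)).add hT.norm).const_mul C
  refine h1.mono (hf.comp_aestronglyMeasurable hT.aestronglyMeasurable)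
    (Eventually.of_forall fun ω => ?_)
  rw [Real.norm_eq_abs, Real.norm_eq_abs]
  exact (h _).trans (le_abs_self _)

lemma integrable_comp_mul_comp (h : IndepFun T X P) (hT : AEMeasurable T P)
    (hX : AEMeasurable X P) {a b : ℝ → ℝ} (ha : Continuous a) (hb : Continuous b)
    (ia : Integrable (fun ω => a (T ω)) P) (ib : Integrable (fun ω => b (X ω)) P) :
    Integrable (fun ω => a (T ω) * b (X ω)) P ∧
      ∫ ω, a (T ω) * b (X ω) ∂P = (∫ ω, a (T ω) ∂P) * ∫ ω, b (X ω) ∂P :=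
  ⟨(h.comp ha.measurable hb.measurable).integrable_mul ia ib,
    h.integral_fun_comp_mul_comp hT hX ha.aestronglyMeasurable hb.aestronglyMeasurable⟩

lemma integrable_abs_pow_three [IsFiniteMeasure P] (hX : MemLp X 3 P) : Integrable (fun ω => |X ω| ^ 3) P := by
  have h : MemLp X ((3 : ℕ) : ℝ≥0∞) P := by rwa [Nat.cast_ofNat]
  exact h.integrable_norm_pow'

lemma integrable_pow_three [IsFiniteMeasure P] (hX : MemLp X 3 P) : Integrable (fun ω => X ω ^ 3) P :=
  (integrable_abs_pow_three hX).mono' (hX.aestronglyMeasurable.pow 3)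
    (Eventually.of_forall fun ω => by simp)

lemma memLp_of_memLp_three [IsFiniteMeasure P] (hX : MemLp X 3 P) {p : ℝ≥0∞} (hp : p ≤ 3) : MemLp X p P :=
  hX.mono_exponent hp

lemma integrable_stein_summand [IsFiniteMeasure P] {k k₁ : ℝ → ℝ} (hT : MemLp T 3 P) (hX : MemLp X 3 P)
    (ck : Continuous k) (ck₁ : Continuous k₁) (gk : LinearGrowth k) (gk₁ : LinearGrowth k₁)
    (c : ℝ) : Integrable (fun ω => c * k₁ (T ω) - X ω * k (T ω)) P := by
  have hT2 := memLp_of_memLp_three hT (show (2 : ℝ≥0∞) ≤ 3 by norm_num)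
  have hX2 := memLp_of_memLp_three hX (show (2 : ℝ≥0∞) ≤ 3 by norm_num)
  exact (((gk₁.memLp ck₁ hT2).integrable one_le_two).const_mul c).sub
    (hX2.integrable_mul (gk.memLp ck hT2))

/-- First-order replacement estimate for the Stein operator. -/
lemma abs_integral_stein_summand_le [IsProbabilityMeasure P] (h : IndepFun T X P) (hT : MemLp T 3 P) (hX : MemLp X 3 P)
    (hm : ∫ ω, X ω ∂P = 0) {σ : ℝ} (hv : ∫ ω, X ω ^ 2 ∂P = σ ^ 2) {k k₁ : ℝ → ℝ}
    (hk : ∀ x, HasDerivAt k (k₁ x) x) (ck₁ : Continuous k₁) (gk : LinearGrowth k) {D : ℝ}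
    (hD : ∀ x y, |k₁ x - k₁ y| ≤ D * |x - y|) :
    |∫ ω, (σ ^ 2 * k₁ (T ω + X ω) - X ω * k (T ω + X ω)) ∂P| ≤
      D * (σ ^ 2 * ∫ ω, |X ω| ∂P + (∫ ω, |X ω| ^ 3 ∂P) / 2) := by
  have ck : Continuous k := continuous_iff_continuousAt.2 fun x => (hk x).continuousAt
  have gk₁ : LinearGrowth k₁ := .of_lipschitz hD
  have hT2 := memLp_of_memLp_three hT (show (2 : ℝ≥0∞) ≤ 3 by norm_num)
  have hX2 := memLp_of_memLp_three hX (show (2 : ℝ≥0∞) ≤ 3 by norm_num)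
  have iX := hX2.integrable one_le_two
  have iX2 := hX2.integrable_sq
  have iX3 := integrable_abs_pow_three hX
  have ik := (gk.memLp ck hT2).integrable one_le_two
  have ik₁ := (gk₁.memLp ck₁ hT2).integrable one_le_two
  obtain ⟨j1, e1⟩ := integrable_comp_mul_comp h hT.aemeasurable hX.aemeasurable
    (b := fun x => σ ^ 2 - x ^ 2) ck₁ (by fun_prop) ik₁ ((integrable_const _).sub iX2)
  obtain ⟨j2, e2⟩ := integrable_comp_mul_comp h hT.aemeasurable hX.aemeasurable
    (b := fun x => x) ck continuous_id ik iX
  rw [integral_sub (integrable_const _) iX2, hv] at e1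
  rw [hm] at e2
  have iS : Integrable (fun ω => σ ^ 2 * k₁ (T ω + X ω) - X ω * k (T ω + X ω)) P :=
    integrable_stein_summand (hT.add hX) hX ck ck₁ gk gk₁ (σ ^ 2)
  have i5 : Integrable (fun ω => k₁ (T ω) * (σ ^ 2 - X ω ^ 2) - k (T ω) * X ω) P := j1.sub j2
  -- The subtracted expression has mean zero: `X` is independent of `T`, centered, and has second
  -- moment `σ ^ 2`.
  have hrem : ∫ ω, (σ ^ 2 * k₁ (T ω + X ω) - X ω * k (T ω + X ω)) ∂P =
      ∫ ω, ((σ ^ 2 * k₁ (T ω + X ω) - X ω * k (T ω + X ω)) -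
        (k₁ (T ω) * (σ ^ 2 - X ω ^ 2) - k (T ω) * X ω)) ∂P := by
    rw [integral_sub iS i5, integral_sub j1 j2, e1, e2]
    simp
  rw [hrem, ← Real.norm_eq_abs]
  have hbound : ∫ ω, D * (σ ^ 2 * |X ω| + |X ω| ^ 3 / 2) ∂P =
      D * (σ ^ 2 * ∫ ω, |X ω| ∂P + (∫ ω, |X ω| ^ 3 ∂P) / 2) := by
    rw [integral_const_mul, integral_add (iX.abs.const_mul _) (iX3.div_const 2),
      integral_const_mul, integral_div]
  rw [← hbound]
  have iB : Integrable (fun ω => D * (σ ^ 2 * |X ω| + |X ω| ^ 3 / 2)) P :=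
    ((iX.abs.const_mul _).add (iX3.div_const 2)).const_mul D
  refine norm_integral_le_of_norm_le iB (Eventually.of_forall fun ω => ?_)
  generalize T ω = t
  generalize X ω = x
  have hD' : ∀ x, |k₁ (t + x) - k₁ t| ≤ D * |x| := fun x => by simpa using hD (t + x) t
  have t1 := abs_taylor_one_le t hk hD' x
  have t2 := hD' x
  rw [Real.norm_eq_abs, show σ ^ 2 * k₁ (t + x) - x * k (t + x) -
    (k₁ t * (σ ^ 2 - x ^ 2) - k t * x) =
    σ ^ 2 * (k₁ (t + x) - k₁ t) - x * (k (t + x) - k t - x * k₁ t) by ring]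
  refine (abs_sub _ _).trans ?_
  rw [abs_mul, abs_mul, abs_of_nonneg (sq_nonneg σ)]
  have t3 := mul_le_mul_of_nonneg_left t2 (sq_nonneg σ)
  have t4 := mul_le_mul_of_nonneg_left t1 (abs_nonneg x)
  rw [← sq_abs x] at t4
  linarith

/-- Second-order replacement estimate for the Stein operator. -/
lemma abs_integral_stein_summand_add_le [IsProbabilityMeasure P] (h : IndepFun T X P) (hT : MemLp T 3 P)
    (hX : MemLp X 3 P) (hm : ∫ ω, X ω ∂P = 0) {σ : ℝ} (hv : ∫ ω, X ω ^ 2 ∂P = σ ^ 2)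
    {g g₁ g₂ : ℝ → ℝ} (hg : ∀ x, HasDerivAt g (g₁ x) x) (hg₁ : ∀ x, HasDerivAt g₁ (g₂ x) x)
    (gg : LinearGrowth g) (gg₁ : LinearGrowth g₁) {M : ℝ}
    (hM : ∀ x y, |g₂ x - g₂ y| ≤ M * |x - y|) {ρ : ℝ → ℝ}
    (hρ : ∀ t x, |x * (g (t + x) - g t - x * g₁ t - x ^ 2 / 2 * g₂ t)| ≤ ρ x)
    (iρ : Integrable (fun ω => ρ (X ω)) P) :
    |∫ ω, (σ ^ 2 * g₁ (T ω + X ω) - X ω * g (T ω + X ω)) ∂P +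
      (∫ ω, X ω ^ 3 ∂P) / 2 * ∫ ω, g₂ (T ω) ∂P| ≤
      σ ^ 4 * M / 2 + ∫ ω, ρ (X ω) ∂P := by
  have cg : Continuous g := continuous_iff_continuousAt.2 fun x => (hg x).continuousAt
  have cg₁ : Continuous g₁ := continuous_iff_continuousAt.2 fun x => (hg₁ x).continuousAt
  have cg₂ : Continuous g₂ := continuous_of_lipschitz hM
  have gg₂ : LinearGrowth g₂ := .of_lipschitz hM
  have hT2 := memLp_of_memLp_three hT (show (2 : ℝ≥0∞) ≤ 3 by norm_num)
  have hX2 := memLp_of_memLp_three hX (show (2 : ℝ≥0∞) ≤ 3 by norm_num)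
  have iX := hX2.integrable one_le_two
  have iX2 := hX2.integrable_sq
  have iX3 := integrable_pow_three hX
  have ig := (gg.memLp cg hT2).integrable one_le_two
  have ig₁ := (gg₁.memLp cg₁ hT2).integrable one_le_two
  have ig₂ := (gg₂.memLp cg₂ hT2).integrable one_le_two
  obtain ⟨j1, e1⟩ := integrable_comp_mul_comp h hT.aemeasurable hX.aemeasurable
    (b := fun x => σ ^ 2 - x ^ 2) cg₁ (by fun_prop) ig₁ ((integrable_const _).sub iX2)
  obtain ⟨j2, e2⟩ := integrable_comp_mul_comp h hT.aemeasurable hX.aemeasurable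
    (b := fun x => x) cg continuous_id ig iX
  obtain ⟨j3, e3⟩ := integrable_comp_mul_comp h hT.aemeasurable hX.aemeasurable
    (b := fun x => σ ^ 2 * x - x ^ 3 / 2) cg₂ (by fun_prop) ig₂
    ((iX.const_mul _).sub (iX3.div_const 2))
  rw [integral_sub (integrable_const _) iX2, hv] at e1
  rw [hm] at e2
  rw [integral_sub (iX.const_mul _) (iX3.div_const 2), integral_const_mul, integral_div, hm] at e3
  have iS : Integrable (fun ω => σ ^ 2 * g₁ (T ω + X ω) - X ω * g (T ω + X ω)) P :=
    integrable_stein_summand (hT.add hX) hX cg cg₁ gg gg₁ (σ ^ 2)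
  have i4 : Integrable (fun ω => g₁ (T ω) * (σ ^ 2 - X ω ^ 2) - g (T ω) * X ω +
      g₂ (T ω) * (σ ^ 2 * X ω - X ω ^ 3 / 2)) P := (j1.sub j2).add j3
  have i5 : Integrable (fun ω => g₁ (T ω) * (σ ^ 2 - X ω ^ 2) - g (T ω) * X ω) P := j1.sub j2
  -- By independence the subtracted expansion around `T` has mean `-(μ₃ / 2) E g₂(T)`, the only term
  -- not killed by the first two moments.
  have hrem : ∫ ω, (σ ^ 2 * g₁ (T ω + X ω) - X ω * g (T ω + X ω)) ∂P +
      (∫ ω, X ω ^ 3 ∂P) / 2 * ∫ ω, g₂ (T ω) ∂P =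
      ∫ ω, ((σ ^ 2 * g₁ (T ω + X ω) - X ω * g (T ω + X ω)) -
        (g₁ (T ω) * (σ ^ 2 - X ω ^ 2) - g (T ω) * X ω +
          g₂ (T ω) * (σ ^ 2 * X ω - X ω ^ 3 / 2))) ∂P := by
    rw [integral_sub iS i4, integral_add i5 j3, integral_sub j1 j2, e1, e2, e3]
    simp
    ring
  rw [hrem, ← Real.norm_eq_abs]
  have hbound : ∫ ω, (σ ^ 2 * M / 2 * X ω ^ 2 + ρ (X ω)) ∂P =
      σ ^ 4 * M / 2 + ∫ ω, ρ (X ω) ∂P := by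
    rw [integral_add (iX2.const_mul _) iρ, integral_const_mul, hv]
    ring
  rw [← hbound]
  have iB : Integrable (fun ω => σ ^ 2 * M / 2 * X ω ^ 2 + ρ (X ω)) P := (iX2.const_mul _).add iρ
  refine norm_integral_le_of_norm_le iB (Eventually.of_forall fun ω => ?_)
  generalize T ω = t
  generalize X ω = x
  have t1 := abs_taylor_one_le t hg₁ (D := M) (fun x => by simpa using hM (t + x) t) x
  rw [Real.norm_eq_abs, show σ ^ 2 * g₁ (t + x) - x * g (t + x) -
    (g₁ t * (σ ^ 2 - x ^ 2) - g t * x + g₂ t * (σ ^ 2 * x - x ^ 3 / 2)) =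
    σ ^ 2 * (g₁ (t + x) - g₁ t - x * g₂ t) -
      x * (g (t + x) - g t - x * g₁ t - x ^ 2 / 2 * g₂ t) by ring]
  refine (abs_sub _ _).trans (add_le_add ?_ (hρ t x))
  rw [abs_mul, abs_of_nonneg (sq_nonneg σ)]
  have t3 := mul_le_mul_of_nonneg_left t1 (sq_nonneg σ)
  linarith

end Summand

/-! ### Normal approximation of sums. -/

/-- Finite families of centered variables with the law of `Y`, each of which is independent of the
sum of the others. -/
structure CenteredFamily {Ω ι : Type*} [MeasurableSpace Ω] (P : Measure Ω) (s : Finset ι)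
    (X : ι → Ω → ℝ) (Y : Ω → ℝ) (σ : ℝ) : Prop where
  indep : ∀ k ∈ s, IndepFun (fun ω => ∑ j ∈ s, X j ω - X k ω) (X k) P
  ident : ∀ k ∈ s, IdentDistrib (X k) Y P P
  memLp : MemLp Y 3 P
  mean : ∫ ω, Y ω ∂P = 0
  var : ∫ ω, Y ω ^ 2 ∂P = σ ^ 2

namespace CenteredFamily

variable {Ω ι : Type*} [MeasurableSpace Ω] {P : Measure Ω} {s : Finset ι}
  {X : ι → Ω → ℝ} {Y : Ω → ℝ} {σ : ℝ}

lemma memLp_of_mem (h : CenteredFamily P s X Y σ) {k : ι} (hk : k ∈ s) : MemLp (X k) 3 P :=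
  (h.ident k hk).memLp_iff.2 h.memLp

lemma memLp_sum (h : CenteredFamily P s X Y σ) : MemLp (fun ω => ∑ j ∈ s, X j ω) 3 P :=
  memLp_finsetSum s fun _ hk => h.memLp_of_mem hk

lemma memLp_sum_sub (h : CenteredFamily P s X Y σ) {k : ι} (hk : k ∈ s) :
    MemLp (fun ω => ∑ j ∈ s, X j ω - X k ω) 3 P :=
  h.memLp_sum.sub (h.memLp_of_mem hk)

lemma integral_comp (h : CenteredFamily P s X Y σ) {k : ι} (hk : k ∈ s) {f : ℝ → ℝ}
    (hf : Measurable f) : ∫ ω, f (X k ω) ∂P = ∫ ω, f (Y ω) ∂P :=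
  ((h.ident k hk).comp hf).integral_eq

lemma integral_eq_zero (h : CenteredFamily P s X Y σ) {k : ι} (hk : k ∈ s) :
    ∫ ω, X k ω ∂P = 0 := by
  rw [(h.ident k hk).integral_eq, h.mean]

lemma integral_sq (h : CenteredFamily P s X Y σ) {k : ι} (hk : k ∈ s) :
    ∫ ω, X k ω ^ 2 ∂P = σ ^ 2 := by
  rw [h.integral_comp hk (f := fun x => x ^ 2) (by fun_prop), h.var]

lemma integral_stein_eq_sum [IsFiniteMeasure P] (h : CenteredFamily P s X Y σ) {k k₁ : ℝ → ℝ}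
    (ck : Continuous k) (ck₁ : Continuous k₁) (gk : LinearGrowth k) (gk₁ : LinearGrowth k₁) :
    ∫ ω, (s.card * σ ^ 2 * k₁ (∑ j ∈ s, X j ω) -
      (∑ j ∈ s, X j ω) * k (∑ j ∈ s, X j ω)) ∂P =
    ∑ i ∈ s, ∫ ω, (σ ^ 2 * k₁ ((∑ j ∈ s, X j ω - X i ω) + X i ω) -
      X i ω * k ((∑ j ∈ s, X j ω - X i ω) + X i ω)) ∂P := by
  simp only [sub_add_cancel]
  rw [← integral_finsetSum _ fun i hi => integrable_stein_summand h.memLp_sum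
    (h.memLp_of_mem hi) ck ck₁ gk gk₁ (σ ^ 2)]
  congr 1
  funext ω
  rw [Finset.sum_sub_distrib, Finset.sum_const, ← Finset.sum_mul, nsmul_eq_mul]
  ring

variable [IsProbabilityMeasure P]

lemma integral_abs_le (h : CenteredFamily P s X Y σ) (hσ : 0 < σ) : ∫ ω, |Y ω| ∂P ≤ σ := by
  have h2 := memLp_of_memLp_three h.memLp (show (2 : ℝ≥0∞) ≤ 3 by norm_num)
  -- Pointwise `2 |Y| σ ≤ Y² + σ²`; the upper bound has integral exactly `σ`.
  have h1 : ∫ ω, |Y ω| ∂P ≤ ∫ ω, (Y ω ^ 2 / (2 * σ) + σ / 2) ∂P := by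
    refine integral_mono (h2.integrable one_le_two).abs
      ((h2.integrable_sq.div_const _).add (integrable_const _)) fun ω => ?_
    have h3 : Y ω ^ 2 / (2 * σ) + σ / 2 - |Y ω| = (|Y ω| - σ) ^ 2 / (2 * σ) := by
      rw [← sq_abs]
      field_simp
      ring
    have h4 : 0 ≤ (|Y ω| - σ) ^ 2 / (2 * σ) := by positivity
    simp only
    linarith
  refine h1.trans_eq ?_
  rw [integral_add (h2.integrable_sq.div_const _) (integrable_const _), integral_div, h.var]
  simp
  field_simp
  ring

/-- Every bound on the Stein solution used below carries a factor `1 / v`; summed over the family it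
yields a quantity independent of the number of terms. -/
lemma card_mul_div (hs : s.Nonempty) (hσ : 0 < σ) {v : NNReal}
    (hv : (v : ℝ) = s.card * σ ^ 2) (c : ℝ) : s.card * (c / v) = c / σ ^ 2 := by
  have : (s.card : ℝ) ≠ 0 := Nat.cast_ne_zero.2 hs.card_pos.ne'
  rw [hv]
  field_simp

lemma variance_ne_zero (hs : s.Nonempty) (hσ : 0 < σ) {v : NNReal}
    (hv : (v : ℝ) = s.card * σ ^ 2) : v ≠ 0 := by
  have : (0 : ℝ) < s.card := Nat.cast_pos.2 hs.card_pos
  rw [← NNReal.coe_ne_zero, hv]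
  positivity

/-- Normal approximation for test functions with bounded continuous derivative. -/
lemma abs_integral_sub_le_of_hasDerivAt (h : CenteredFamily P s X Y σ) (hs : s.Nonempty)
    (hσ : 0 < σ) {v : NNReal} (hv : (v : ℝ) = s.card * σ ^ 2) {H H' : ℝ → ℝ}
    (hH : ∀ x, HasDerivAt H (H' x) x) (hc : Continuous H') {L : ℝ} (hL : ∀ x, |H' x| ≤ L) :
    |∫ ω, H (∑ j ∈ s, X j ω) ∂P - ∫ x, H x ∂gaussianReal 0 v| ≤
      L * (2 * ∫ ω, |Y ω| ∂P + (∫ ω, |Y ω| ^ 3 ∂P) / σ ^ 2) := by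
  have hv0 := variance_ne_zero hs hσ hv
  have hS := SteinData.of_bounded hv0 hc hL
  have cH : Continuous H := continuous_iff_continuousAt.2 fun x => (hH x).continuousAt
  have gH : LinearGrowth H := .of_lipschitz (abs_sub_le_of_hasDerivAt hH hL)
  have hD := abs_sub_le_of_hasDerivAt hS.hasDerivAt₁ (abs_gaussSol₂_le hL)
  have i1 : Integrable (fun ω => H (∑ j ∈ s, X j ω)) P :=
    (gH.memLp cH h.memLp_sum).integrable (by norm_num)
  have e1 : ∫ ω, H (∑ j ∈ s, X j ω) ∂P - ∫ x, H x ∂gaussianReal 0 v =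
      ∫ ω, (s.card * σ ^ 2 * gaussSol₁ v H' (∑ j ∈ s, X j ω) -
        (∑ j ∈ s, X j ω) * gaussSol v H' (∑ j ∈ s, X j ω)) ∂P := by
    rw [← hv]
    simp only [hS.eq_sub_integral hH gH.polyGrowth]
    rw [integral_sub i1 (integrable_const _)]
    simp
  rw [e1, h.integral_stein_eq_sum hS.cont₀ hS.cont₁ hS.growth₀ hS.growth₁]
  refine (Finset.abs_sum_le_sum_abs _ _).trans ?_
  have h2 : ∀ i ∈ s, |∫ ω, (σ ^ 2 * gaussSol₁ v H' ((∑ j ∈ s, X j ω - X i ω) + X i ω) -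
      X i ω * gaussSol v H' ((∑ j ∈ s, X j ω - X i ω) + X i ω)) ∂P| ≤
      2 * L / v * (σ ^ 2 * ∫ ω, |Y ω| ∂P + (∫ ω, |Y ω| ^ 3 ∂P) / 2) := by
    intro i hi
    have := abs_integral_stein_summand_le (h.indep i hi) (h.memLp_sum_sub hi) (h.memLp_of_mem hi)
      (h.integral_eq_zero hi) (h.integral_sq hi) hS.hasDerivAt hS.cont₁ hS.growth₀ hD
    rwa [h.integral_comp hi (f := fun x => |x|) (by fun_prop),
      h.integral_comp hi (f := fun x => |x| ^ 3) (by fun_prop)] at this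
  refine (Finset.sum_le_card_nsmul _ _ _ h2).trans_eq ?_
  rw [nsmul_eq_mul, ← mul_assoc, card_mul_div hs hσ hv]
  field_simp

/-- Normal approximation for Lipschitz test functions. -/
lemma abs_integral_sub_le_of_lipschitz (h : CenteredFamily P s X Y σ) (hs : s.Nonempty)
    (hσ : 0 < σ) {v : NNReal} (hv : (v : ℝ) = s.card * σ ^ 2) {H : ℝ → ℝ} {L : ℝ}
    (hL : ∀ x y, |H x - H y| ≤ L * |x - y|) :
    |∫ ω, H (∑ j ∈ s, X j ω) ∂P - ∫ x, H x ∂gaussianReal 0 v| ≤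
      L * (2 * ∫ ω, |Y ω| ∂P + (∫ ω, |Y ω| ^ 3 ∂P) / σ ^ 2) := by
  have cH := continuous_of_lipschitz hL
  have gH : LinearGrowth H := .of_lipschitz hL
  have hL0 : 0 ≤ L := by simpa using (abs_nonneg _).trans (hL 1 0)
  refine le_of_forall_pos_le_add fun δ hδ => ?_
  obtain ⟨ε, hε, hεδ⟩ : ∃ ε, 0 < ε ∧ L * ε ≤ δ := by
    refine ⟨δ / (L + 1), by positivity, ?_⟩
    rw [mul_div_assoc', div_le_iff₀ (by positivity)]
    nlinarith
  set A : ℝ → ℝ := fun x => ∫ t in (0 : ℝ)..x, H t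
  have hA : ∀ x, HasDerivAt A (H x) x := fun x => intervalIntegral.integral_hasDerivAt_right
    (cH.intervalIntegrable _ _) cH.aestronglyMeasurable.stronglyMeasurableAtFilter cH.continuousAt
  -- Averaging `H` over `[x, x + ε]` gives a function with continuous derivative bounded by `L`, at
  -- uniform distance at most `L * ε / 2` from `H`.
  set K : ℝ → ℝ := fun x => (A (x + ε) - A x) / ε
  have hK : ∀ x, HasDerivAt K ((H (x + ε) - H x) / ε) x := fun x =>
    ((HasDerivAt.comp_add_const x ε (hA (x + ε))).sub (hA x)).div_const ε
  have hK' : ∀ x, |(H (x + ε) - H x) / ε| ≤ L := by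
    intro x
    rw [abs_div, abs_of_pos hε, div_le_iff₀ hε]
    simpa [abs_of_pos hε] using hL (x + ε) x
  have hKH : ∀ x, |K x - H x| ≤ L * ε / 2 := by
    intro x
    have h1 := abs_taylor_one_le x hA (D := L) (fun y => by simpa using hL (x + y) x) ε
    have h2 : K x - H x = (A (x + ε) - A x - ε * H x) / ε := by
      simp only [K]
      field_simp
    rw [h2, abs_div, abs_of_pos hε, div_le_iff₀ hε]
    refine h1.trans_eq ?_
    ring
  have cK : Continuous K := continuous_iff_continuousAt.2 fun x => (hK x).continuousAt
  have gK : LinearGrowth K := .of_lipschitz (abs_sub_le_of_hasDerivAt hK hK')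
  have h1 := h.abs_integral_sub_le_of_hasDerivAt hs hσ hv hK (by fun_prop) hK'
  have close : ∀ {Q : Measure ℝ} [IsProbabilityMeasure Q], Integrable K Q → Integrable H Q →
      |∫ x, K x ∂Q - ∫ x, H x ∂Q| ≤ L * ε / 2 := by
    intro Q _ iK iH
    rw [← integral_sub iK iH]
    have := norm_integral_le_of_norm_le_const (μ := Q) (f := fun x => K x - H x)
      (Eventually.of_forall hKH)
    simpa using this
  have hm : AEMeasurable (fun ω => ∑ j ∈ s, X j ω) P := h.memLp_sum.aemeasurable
  have := Measure.isProbabilityMeasure_map hm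
  have hmap : ∀ F : ℝ → ℝ, Continuous F →
      ∫ ω, F (∑ j ∈ s, X j ω) ∂P = ∫ x, F x ∂P.map (fun ω => ∑ j ∈ s, X j ω) :=
    fun F hF => (integral_map hm hF.aestronglyMeasurable).symm
  have himap : ∀ F : ℝ → ℝ, Continuous F → LinearGrowth F →
      Integrable F (P.map (fun ω => ∑ j ∈ s, X j ω)) := fun F hF gF =>
    (integrable_map_measure hF.aestronglyMeasurable hm).2
      ((gF.memLp hF h.memLp_sum).integrable (by norm_num))
  have c1 := close (himap K cK gK) (himap H cH gH)
  have c2 := close (gK.polyGrowth.integrable cK v) (gH.polyGrowth.integrable cH v)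
  rw [hmap K cK] at h1
  rw [hmap H cH]
  rw [abs_le] at h1 c1 c2 ⊢
  constructor <;> linarith [h1.1, h1.2, c1.1, c1.2, c2.1, c2.2]

/-- Bound for the third-order remainder in the Stein expansion for a primitive of `φ' ∘ w`. -/
lemma _root_.CostClass.abs_remainder_le {φ : ℝ → ℝ} (hφ : CostClass φ) {w : ℝ → ℝ}
    (hw : ∀ x y, |w x - w y| ≤ |x - y|) {v : NNReal} (hv : v ≠ 0) (t x : ℝ) :
    |x * (gaussSol v (fun y => deriv φ (w y)) (t + x) - gaussSol v (fun y => deriv φ (w y)) t -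
      x * gaussSol₁ v (fun y => deriv φ (w y)) t -
      x ^ 2 / 2 * gaussSol₂ v (fun y => deriv φ (w y)) t)| ≤
      2 / v * (|x| ^ 3 * deriv φ (|x| / 4)) := by
  rcases eq_or_ne x 0 with rfl | hx
  · simp
  set p : ℝ → ℝ := fun y => deriv φ (w y)
  have hp : ∀ x y, |p x - p y| ≤ 1 * |x - y| := fun x y => by
    rw [one_mul]
    exact (hφ.abs_deriv_sub_le _ _).trans (hw x y)
  have hS := SteinData.of_lipschitz hv hp
  have hx0 : 0 < |x| := abs_pos.2 hx
  have cw : Continuous w := continuous_of_lipschitz (B := 1) (by simpa using hw)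
  -- The level of the splitting depends on the size of the summand. By linearity `g''` splits too:
  -- the first part is bounded by `2 * A / v`, the second is `2 * m / v`-Lipschitz.
  obtain ⟨m, q, hm0, hma, cq, hq, hqm⟩ := hφ.exists_split (a := |x| / 4) (by positivity)
  set A := deriv φ (|x| / 4) - |x| / 4 * m
  have gq : LinearGrowth fun y => q (w y) := .of_bounded fun y => hq (w y)
  have hr : ∀ x y, |(p x - q (w x)) - (p y - q (w y))| ≤ m * |x - y| := fun x y =>
    (hqm _ _).trans (mul_le_mul_of_nonneg_left (hw x y) hm0)
  have hsplit : ∀ y, gaussSol₂ v p y =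
      gaussSol₂ v (fun y => q (w y)) y + gaussSol₂ v (fun y => p y - q (w y)) y := fun y => by
    rw [gaussSol₂_sub (q := fun y => q (w y)) hS.cont hS.growth (cq.comp cw) gq]
    ring
  have hmod : ∀ y, |gaussSol₂ v p (t + y) - gaussSol₂ v p t| ≤ 4 * A / v + 2 * m / v * |y| := by
    intro y
    have h1 := abs_gaussSol₂_le (v := v) (p := fun y => q (w y)) (fun y => hq (w y)) (t + y)
    have h2 := abs_gaussSol₂_le (v := v) (p := fun y => q (w y)) (fun y => hq (w y)) t
    have h3 := abs_gaussSol₂_sub_le hv hr (t + y) t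
    rw [add_sub_cancel_left] at h3
    rw [hsplit, hsplit, add_sub_add_comm]
    refine (abs_add_le _ _).trans (add_le_add ((abs_sub _ _).trans ?_) h3)
    refine (add_le_add h1 h2).trans_eq ?_
    ring
  have h1 := abs_taylor_two_le t hS.hasDerivAt hS.hasDerivAt₁ hmod x
  rw [abs_mul]
  refine (mul_le_mul_of_nonneg_left h1 hx0.le).trans ?_
  have hv' : (0 : ℝ) < v := NNReal.coe_pos.2 (pos_iff_ne_zero.2 hv)
  have h2 : |x| * (4 * A / v * x ^ 2 / 2 + 2 * m / v * |x| ^ 3 / 6) =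
      2 / v * (|x| ^ 3 * (A + m * |x| / 6)) := by
    rw [← sq_abs x]
    ring
  rw [h2]
  refine mul_le_mul_of_nonneg_left (mul_le_mul_of_nonneg_left ?_ (by positivity)) (by positivity)
  simp only [A]
  -- The Lipschitz part contributes `m |x| / 6`, absorbed by the `-m |x| / 4` contained in `A`.
  nlinarith [mul_nonneg hm0 hx0.le]

/-- Second-order normal approximation for a primitive of `φ' ∘ w`. -/
lemma integral_sub_le (h : CenteredFamily P s X Y σ) (hs : s.Nonempty)
    (hσ : 0 < σ) {v : NNReal} (hv : (v : ℝ) = s.card * σ ^ 2) {φ : ℝ → ℝ} (hφ : CostClass φ)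
    {w : ℝ → ℝ} (hw : ∀ x y, |w x - w y| ≤ |x - y|) {f : ℝ → ℝ}
    (hf : ∀ x, HasDerivAt f (deriv φ (w x)) x)
    (hint : Integrable (fun ω => |Y ω| ^ 3 * deriv φ (|Y ω| / 4)) P) :
    ∫ ω, f (∑ j ∈ s, X j ω) ∂P - ∫ x, f x ∂gaussianReal 0 v ≤
      -(s.card * (∫ ω, Y ω ^ 3 ∂P) / 2 *
        ∫ x, gaussSol₂ v (fun y => deriv φ (w y)) x ∂gaussianReal 0 v) +
      (σ ^ 2 + 2 / σ ^ 2 * ∫ ω, |Y ω| ^ 3 * deriv φ (|Y ω| / 4) ∂P +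
        |∫ ω, Y ω ^ 3 ∂P| / σ ^ 2 * (3 * ∫ ω, |Y ω| ∂P + (∫ ω, |Y ω| ^ 3 ∂P) / σ ^ 2)) := by
  have hv0 := variance_ne_zero hs hσ hv
  have hv' : (0 : ℝ) < v := NNReal.coe_pos.2 (pos_iff_ne_zero.2 hv0)
  set p : ℝ → ℝ := fun y => deriv φ (w y)
  have hp : ∀ x y, |p x - p y| ≤ 1 * |x - y| := fun x y => by
    rw [one_mul]
    exact (hφ.abs_deriv_sub_le _ _).trans (hw x y)
  have hS := SteinData.of_lipschitz hv0 hp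
  have cf : Continuous f := continuous_iff_continuousAt.2 fun x => (hf x).continuousAt
  obtain ⟨C, hC, hfC⟩ := hS.growth.primitive hf
  have i1 : Integrable (fun ω => f (∑ j ∈ s, X j ω)) P :=
    integrable_of_abs_le_sq (memLp_of_memLp_three h.memLp_sum (by norm_num)) cf hfC
  have hM : ∀ x y, |gaussSol₂ v p x - gaussSol₂ v p y| ≤ 2 / v * |x - y| := by
    simpa using abs_gaussSol₂_sub_le hv0 hp
  have g2 : LinearGrowth (gaussSol₂ v p) := .of_lipschitz hM
  have e1 : ∫ ω, f (∑ j ∈ s, X j ω) ∂P - ∫ x, f x ∂gaussianReal 0 v =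
      ∫ ω, (s.card * σ ^ 2 * gaussSol₁ v p (∑ j ∈ s, X j ω) -
        (∑ j ∈ s, X j ω) * gaussSol v p (∑ j ∈ s, X j ω)) ∂P := by
    rw [← hv]
    simp only [hS.eq_sub_integral hf ⟨C, 2, hC, hfC⟩]
    rw [integral_sub i1 (integrable_const _)]
    simp
  rw [e1, h.integral_stein_eq_sum hS.cont₀ hS.cont₁ hS.growth₀ hS.growth₁]
  set μ₃ := ∫ ω, Y ω ^ 3 ∂P
  set R := ∫ ω, |Y ω| ^ 3 * deriv φ (|Y ω| / 4) ∂P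
  set E₁ := ∫ ω, |Y ω| ∂P
  set E₃ := ∫ ω, |Y ω| ^ 3 ∂P
  set G := ∫ x, gaussSol₂ v p x ∂gaussianReal 0 v
  have cd := hφ.continuous_deriv
  have hlip := h.abs_integral_sub_le_of_lipschitz hs hσ hv hM
  have hsummand : ∀ i ∈ s, ∫ ω, (σ ^ 2 * gaussSol₁ v p ((∑ j ∈ s, X j ω - X i ω) + X i ω) -
      X i ω * gaussSol v p ((∑ j ∈ s, X j ω - X i ω) + X i ω)) ∂P ≤
      -(μ₃ / 2 * G) + (σ ^ 4 / v + 2 / v * R + |μ₃| / v * (3 * E₁ + E₃ / σ ^ 2)) := by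
    intro i hi
    have iρ : Integrable (fun ω => 2 / v * (|X i ω| ^ 3 * deriv φ (|X i ω| / 4))) P :=
      (((h.ident i hi).comp (u := fun x => |x| ^ 3 * deriv φ (|x| / 4))
        (by fun_prop)).integrable_iff.2 hint).const_mul _
    have h1 := abs_integral_stein_summand_add_le (h.indep i hi) (h.memLp_sum_sub hi)
      (h.memLp_of_mem hi) (h.integral_eq_zero hi) (h.integral_sq hi) hS.hasDerivAt
      hS.hasDerivAt₁ hS.growth₀ hS.growth₁ hM
      (ρ := fun x => 2 / v * (|x| ^ 3 * deriv φ (|x| / 4)))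
      (fun t x => hφ.abs_remainder_le hw hv0 t x) iρ
    rw [h.integral_comp hi (f := fun x => x ^ 3) (by fun_prop),
      h.integral_comp hi (f := fun x => 2 / v * (|x| ^ 3 * deriv φ (|x| / 4)))
      (by fun_prop), integral_const_mul] at h1
    have iS : Integrable (fun ω => gaussSol₂ v p (∑ j ∈ s, X j ω)) P :=
      (g2.memLp hS.cont₂ h.memLp_sum).integrable (by norm_num)
    have iT : Integrable (fun ω => gaussSol₂ v p (∑ j ∈ s, X j ω - X i ω)) P :=
      (g2.memLp hS.cont₂ (h.memLp_sum_sub hi)).integrable (by norm_num)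
    have h2 : |∫ ω, gaussSol₂ v p (∑ j ∈ s, X j ω - X i ω) ∂P -
        ∫ ω, gaussSol₂ v p (∑ j ∈ s, X j ω) ∂P| ≤ 2 / v * E₁ := by
      have hE : E₁ = ∫ ω, |X i ω| ∂P := (h.integral_comp hi (f := fun x => |x|) (by fun_prop)).symm
      rw [← integral_sub iT iS, hE, ← integral_const_mul, ← Real.norm_eq_abs]
      refine norm_integral_le_of_norm_le
        (((h.memLp_of_mem hi).integrable (by norm_num)).abs.const_mul _)
        (Eventually.of_forall fun ω => ?_)
      simpa using hM (∑ j ∈ s, X j ω - X i ω) (∑ j ∈ s, X j ω)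
    -- `g''` is itself Lipschitz with constant `2 / v`, so the leave-one-out sum may be replaced by
    -- the full sum and then, by the first-order normal approximation, by the Gaussian.
    have h3 : |∫ ω, gaussSol₂ v p (∑ j ∈ s, X j ω - X i ω) ∂P - G| ≤
        2 / v * (3 * E₁ + E₃ / σ ^ 2) := by
      refine (abs_sub_le _ _ _).trans ((add_le_add h2 hlip).trans_eq ?_)
      ring
    have h4 : |μ₃ / 2 * (∫ ω, gaussSol₂ v p (∑ j ∈ s, X j ω - X i ω) ∂P - G)| ≤
        |μ₃| / v * (3 * E₁ + E₃ / σ ^ 2) := by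
      rw [abs_mul, abs_div, abs_two]
      refine (mul_le_mul_of_nonneg_left h3 (by positivity)).trans_eq ?_
      ring
    have h5 := (abs_le.1 h1).2
    have h6 := (abs_le.1 h4).1
    have h7 : σ ^ 4 * (2 / (v : ℝ)) / 2 = σ ^ 4 / v := by ring
    rw [h7] at h5
    linarith
  refine (Finset.sum_le_card_nsmul _ _ _ hsummand).trans_eq ?_
  have k1 := card_mul_div hs hσ hv (σ ^ 4)
  have k2 := card_mul_div hs hσ hv 2
  have k3 := card_mul_div hs hσ hv |μ₃|
  have k4 : σ ^ 4 / σ ^ 2 = σ ^ 2 := by field_simp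
  rw [nsmul_eq_mul]
  linear_combination k1 + R * k2 + (3 * E₁ + E₃ / σ ^ 2) * k3 + k4

end CenteredFamily

/-! ### Triangle inequality for the transport distance. -/

/-- Gluing of two couplings with a common marginal. -/
lemma exists_gluing {μ ν ρ : Measure ℝ} [IsProbabilityMeasure ν] {π₁ π₂ : Measure (ℝ × ℝ)}
    (h₁ : π₁ ∈ couplings μ ν) (h₂ : π₂ ∈ couplings ν ρ) :
    ∃ τ : Measure ((ℝ × ℝ) × ℝ), τ.map Prod.fst = π₁ ∧
      τ.map (fun ω => (ω.1.2, ω.2)) = π₂ := by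
  have hp₁ : IsProbabilityMeasure π₁ := by
    have : IsProbabilityMeasure (π₁.map Prod.snd) := by rw [h₁.2]; infer_instance
    exact Measure.isProbabilityMeasure_of_map (f := Prod.snd)
  have hp₂ : IsProbabilityMeasure π₂ := by
    have : IsProbabilityMeasure (π₂.map Prod.fst) := by rw [h₂.1]; infer_instance
    exact Measure.isProbabilityMeasure_of_map (f := Prod.fst)
  -- Given the pair drawn from `π₁`, the third coordinate is drawn from the conditional law under
  -- `π₂` given the middle one.
  refine ⟨π₁ ⊗ₘ (π₂.condKernel.comap Prod.snd measurable_snd), Measure.fst_compProd _ _, ?_⟩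
  refine Measure.ext_of_lintegral _ fun f hf => ?_
  rw [lintegral_map hf (by fun_prop), Measure.lintegral_compProd (by fun_prop)]
  have h3 : π₂ = (π₁.map Prod.snd) ⊗ₘ π₂.condKernel := by
    rw [h₁.2, ← h₂.1]
    exact (π₂.disintegrate π₂.condKernel).symm
  conv_rhs => rw [h3]
  rw [Measure.lintegral_compProd hf, lintegral_map _ measurable_snd]
  · rfl
  · exact hf.lintegral_kernel_prod_right'

lemma ofReal_sqrt_rpow_two {x : ℝ} (hx : 0 ≤ x) :
    ENNReal.ofReal √x ^ (2 : ℝ) = ENNReal.ofReal x := by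
  rw [ENNReal.ofReal_rpow_of_nonneg (Real.sqrt_nonneg x) (by norm_num)]
  congr 1
  rw [Real.rpow_two, Real.sq_sqrt hx]

/-- The triangle inequality for the transport distance. -/
theorem transportDist_triangle {φ : ℝ → ℝ} (h : CostClass φ) (μ ν ρ : Measure ℝ)
    [IsProbabilityMeasure ν] :
    transportDist φ μ ρ ≤ transportDist φ μ ν + transportDist φ ν ρ := by
  have cφ := h.contDiff.continuous
  have key : ∀ π₁ ∈ couplings μ ν, ∀ π₂ ∈ couplings ν ρ, transportDist φ μ ρ ≤
      (∫⁻ z, ENNReal.ofReal (φ (z.1 - z.2)) ∂π₁) ^ (1 / 2 : ℝ) +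
      (∫⁻ z, ENNReal.ofReal (φ (z.1 - z.2)) ∂π₂) ^ (1 / 2 : ℝ) := by
    intro π₁ h₁ π₂ h₂
    obtain ⟨τ, hτ₁, hτ₂⟩ := exists_gluing h₁ h₂
    have m₁ : Measurable fun z : ℝ × ℝ => ENNReal.ofReal (φ (z.1 - z.2)) := by fun_prop
    have e₁ : τ.map (fun ω => ω.1.1) = μ := by
      rw [← h₁.1, ← hτ₁, Measure.map_map measurable_fst measurable_fst]
      rfl
    have e₂ : τ.map (fun ω => ω.2) = ρ := by
      rw [← h₂.2, ← hτ₂, Measure.map_map measurable_snd (by fun_prop)]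
      rfl
    have hcost := transportCost_le_lintegral (P := τ) cφ
      (Y := fun ω => ω.1.1) (Z := fun ω => ω.2) (by fun_prop) (by fun_prop)
    rw [e₁, e₂] at hcost
    rw [← hτ₁, ← hτ₂, lintegral_map m₁ measurable_fst, lintegral_map m₁ (by fun_prop)]
    have f₁ : Measurable fun ω : (ℝ × ℝ) × ℝ => ENNReal.ofReal √(φ (ω.1.1 - ω.1.2)) := by fun_prop
    have f₂ : Measurable fun ω : (ℝ × ℝ) × ℝ => ENNReal.ofReal √(φ (ω.1.2 - ω.2)) := by fun_prop
    have hmink := ENNReal.lintegral_Lp_add_le (p := 2) (μ := τ) f₁.aemeasurable f₂.aemeasurable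
      (by norm_num)
    simp only [ofReal_sqrt_rpow_two (h.nonneg _)] at hmink
    refine le_trans (ENNReal.rpow_le_rpow (hcost.trans (lintegral_mono fun ω => ?_))
      (by norm_num)) hmink
    rw [Pi.add_apply, ← ENNReal.ofReal_add (Real.sqrt_nonneg _) (Real.sqrt_nonneg _),
      ← ofReal_sqrt_rpow_two (h.nonneg _)]
    refine ENNReal.rpow_le_rpow (ENNReal.ofReal_le_ofReal ?_) (by norm_num)
    have := h.sqrt_add_le (ω.1.1 - ω.1.2) (ω.1.2 - ω.2)
    rwa [sub_add_sub_cancel] at this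
  -- The power `1 / 2` is an order isomorphism of `ℝ≥0∞`, so it commutes with the infimum over
  -- couplings, including when that infimum is `∞`.
  have hinf : ∀ α β : Measure ℝ, transportDist φ α β = ⨅ π ∈ couplings α β,
      (∫⁻ z, ENNReal.ofReal (φ (z.1 - z.2)) ∂π) ^ (1 / 2 : ℝ) := by
    intro α β
    have := (ENNReal.orderIsoRpow (1 / 2) (by norm_num)).map_iInf₂
      (fun (π : Measure (ℝ × ℝ)) (_ : π ∈ couplings α β) =>
        ∫⁻ z, ENNReal.ofReal (φ (z.1 - z.2)) ∂π)
    exact this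
  rw [hinf μ ν, hinf ν ρ]
  simp only [ENNReal.iInf_add, ENNReal.add_iInf]
  exact le_iInf₂ fun π₂ h₂ => le_iInf₂ fun π₁ h₁ => key π₁ h₁ π₂ h₂

/-! ### Skewness correction of the Gaussian. -/

/-- The second Hermite polynomial, normalized by the variance. -/
noncomputable def hermiteTwo (v : NNReal) (x : ℝ) : ℝ := x ^ 2 / v - 1

lemma continuous_hermiteTwo (v : NNReal) : Continuous (hermiteTwo v) := by
  unfold hermiteTwo
  fun_prop

lemma polyGrowth_hermiteTwo (v : NNReal) : PolyGrowth (hermiteTwo v) := by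
  have := ((PolyGrowth.id.pow 2).mul (.const (v : ℝ)⁻¹)).sub (.const 1)
  change PolyGrowth fun x => x ^ 2 / (v : ℝ) - 1
  simpa only [div_eq_mul_inv] using this

section GaussianMoments

variable {v : NNReal}

lemma integral_sq_gaussianReal (hv : v ≠ 0) : ∫ x, x ^ 2 ∂gaussianReal 0 v = v := by
  have := integral_id_mul_gaussianReal hv (f := fun x => x) (f' := fun _ => 1)
    (fun x => hasDerivAt_id x) continuous_const .id (.const 1)
  simpa [← sq] using this

lemma integral_pow_four_gaussianReal (hv : v ≠ 0) :
    ∫ x, x ^ 4 ∂gaussianReal 0 v = 3 * v ^ 2 := by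
  have := integral_id_mul_gaussianReal hv (f := fun x => x ^ 3) (f' := fun x => 3 * x ^ 2)
    (fun x => by simpa using hasDerivAt_pow 3 x) (by fun_prop) (PolyGrowth.id.pow 3)
    ((PolyGrowth.const 3).mul (PolyGrowth.id.pow 2))
  rw [integral_const_mul, integral_sq_gaussianReal hv] at this
  rw [show (fun x : ℝ => x ^ 4) = fun x => x * x ^ 3 by funext x; ring, this]
  ring

lemma integral_hermiteTwo (hv : v ≠ 0) : ∫ x, hermiteTwo v x ∂gaussianReal 0 v = 0 := by
  have hv' : (v : ℝ) ≠ 0 := NNReal.coe_ne_zero.2 hv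
  simp only [hermiteTwo]
  rw [integral_sub ((((PolyGrowth.id.pow 2).integrable (by fun_prop) v)).div_const _)
    (integrable_const _), integral_div, integral_sq_gaussianReal hv]
  simp [hv']

lemma integral_hermiteTwo_sq (hv : v ≠ 0) :
    ∫ x, hermiteTwo v x ^ 2 ∂gaussianReal 0 v = 2 := by
  have hv' : (v : ℝ) ≠ 0 := NNReal.coe_ne_zero.2 hv
  have i4 := (PolyGrowth.id.pow 4).integrable (by fun_prop) v
  have i2 := (PolyGrowth.id.pow 2).integrable (by fun_prop) v
  have h1 : ∀ x : ℝ, hermiteTwo v x ^ 2 = ((v : ℝ) ^ 2)⁻¹ * x ^ 4 - (2 / v * x ^ 2 - 1) := by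
    intro x
    simp only [hermiteTwo]
    field_simp
    ring
  have i1 : Integrable (fun x : ℝ => 2 / (v : ℝ) * x ^ 2 - 1) (gaussianReal 0 v) :=
    (i2.const_mul _).sub (integrable_const _)
  simp only [h1]
  rw [integral_sub (i4.const_mul _) i1, integral_sub (i2.const_mul _) (integrable_const _),
    integral_const_mul, integral_const_mul, integral_sq_gaussianReal hv,
    integral_pow_four_gaussianReal hv]
  simp
  field_simp
  norm_num

end GaussianMoments

/-- Quadratic perturbation of the identity, used to correct the skewness of the normal law. -/
noncomputable def skewMap (v : NNReal) (c : ℝ) (x : ℝ) : ℝ := x + c * hermiteTwo v x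

lemma continuous_skewMap (v : NNReal) (c : ℝ) : Continuous (skewMap v c) :=
  continuous_id.add (continuous_const.mul (continuous_hermiteTwo v))

lemma polyGrowth_skewMap (v : NNReal) (c : ℝ) : PolyGrowth (skewMap v c) :=
  PolyGrowth.id.add ((PolyGrowth.const c).mul (polyGrowth_hermiteTwo v))

/-- Couple `G` with its own image and use `φ x ≤ x ^ 2 / 2`; the second Hermite polynomial has
second moment `2`. -/
lemma transportDist_skewMap_le {φ : ℝ → ℝ} (h : CostClass φ) {v : NNReal} (hv : v ≠ 0) (c : ℝ) :
    transportDist φ ((gaussianReal 0 v).map (skewMap v c)) (gaussianReal 0 v) ≤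
      ENNReal.ofReal |c| := by
  have h1 := transportCost_le_lintegral (P := gaussianReal 0 v) h.contDiff.continuous
    (continuous_skewMap v c).aemeasurable (aemeasurable_id (μ := gaussianReal 0 v))
  rw [Measure.map_id] at h1
  have i1 : Integrable (fun x => c ^ 2 / 2 * hermiteTwo v x ^ 2) (gaussianReal 0 v) :=
    ((polyGrowth_hermiteTwo v).pow 2 |>.integrable ((continuous_hermiteTwo v).pow 2) v).const_mul _
  have h2 : ∫⁻ x, ENNReal.ofReal (φ (skewMap v c x - id x)) ∂gaussianReal 0 v ≤
      ENNReal.ofReal (c ^ 2) := by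
    have h3 : c ^ 2 = ∫ x, c ^ 2 / 2 * hermiteTwo v x ^ 2 ∂gaussianReal 0 v := by
      rw [integral_const_mul, integral_hermiteTwo_sq hv]
      ring
    rw [h3, ofReal_integral_eq_lintegral_ofReal i1 (Eventually.of_forall fun x => by positivity)]
    refine lintegral_mono fun x => ENNReal.ofReal_le_ofReal ((h.le_sq_div_two _).trans_eq ?_)
    simp only [skewMap, id]
    ring
  refine (ENNReal.rpow_le_rpow (h1.trans h2) (by norm_num)).trans_eq ?_
  rw [ENNReal.ofReal_rpow_of_nonneg (sq_nonneg c) (by norm_num), ← Real.sqrt_eq_rpow,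
    Real.sqrt_sq_eq_abs]

/-- Taylor's formula with `f'` 1-Lipschitz; the first-order term is the Hermite coefficient of `f'`,
evaluated by `SteinData.integral_hermite`, and the second-order error integrates to `c ^ 2`. -/
lemma integral_comp_skewMap_ge {φ : ℝ → ℝ} (hφ : CostClass φ) {w : ℝ → ℝ}
    (hw : ∀ x y, |w x - w y| ≤ |x - y|) {v : NNReal} (hv : v ≠ 0) (c : ℝ) {f : ℝ → ℝ}
    (hf : ∀ x, HasDerivAt f (deriv φ (w x)) x) (hfg : PolyGrowth f)
    (hfR : Integrable (fun x => f (skewMap v c x)) (gaussianReal 0 v)) :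
    ∫ x, f x ∂gaussianReal 0 v -
        3 * v * c * ∫ x, gaussSol₂ v (fun y => deriv φ (w y)) x ∂gaussianReal 0 v - c ^ 2 ≤
      ∫ x, f (skewMap v c x) ∂gaussianReal 0 v := by
  have hp : ∀ x y, |deriv φ (w x) - deriv φ (w y)| ≤ 1 * |x - y| := fun x y => by
    rw [one_mul]
    exact (hφ.abs_deriv_sub_le _ _).trans (hw x y)
  have hS := SteinData.of_lipschitz hv hp
  have cf : Continuous f := continuous_iff_continuousAt.2 fun x => (hf x).continuousAt
  have i1 := hfg.integrable cf v
  have i2 := (hS.growth.polyGrowth.mul (polyGrowth_hermiteTwo v)).integrable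
    (hS.cont.mul (continuous_hermiteTwo v)) v
  have i3 := ((polyGrowth_hermiteTwo v).pow 2).integrable ((continuous_hermiteTwo v).pow 2) v
  have e : ∫ x, f x ∂gaussianReal 0 v -
      3 * v * c * ∫ x, gaussSol₂ v (fun y => deriv φ (w y)) x ∂gaussianReal 0 v - c ^ 2 =
      ∫ x, (f x + c * (deriv φ (w x) * hermiteTwo v x) - c ^ 2 / 2 * hermiteTwo v x ^ 2)
        ∂gaussianReal 0 v := by
    have i4 : Integrable (fun x => f x + c * (deriv φ (w x) * hermiteTwo v x))
      (gaussianReal 0 v) := i1.add (i2.const_mul c)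
    have e2 : ∫ x, deriv φ (w x) * hermiteTwo v x ∂gaussianReal 0 v = _ := hS.integral_hermite
    rw [integral_sub i4 (i3.const_mul _), integral_add i1 (i2.const_mul c), integral_const_mul,
      integral_const_mul, integral_hermiteTwo_sq hv, e2]
    ring
  rw [e]
  refine integral_mono ((i1.add (i2.const_mul c)).sub (i3.const_mul _)) hfR fun x => ?_
  have t1 := abs_taylor_one_le x hf (D := 1) (fun y => by simpa using hp (x + y) x)
    (c * hermiteTwo v x)
  have t2 := (abs_le.1 t1).1
  simp only [skewMap]
  linarith

/-! ### Combination of the estimates. -/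

namespace CenteredFamily

variable {Ω ι : Type*} [MeasurableSpace Ω] {P : Measure Ω} [IsProbabilityMeasure P]
  {s : Finset ι} {X : ι → Ω → ℝ} {Y : Ω → ℝ} {σ : ℝ}

lemma transportCost_le (h : CenteredFamily P s X Y σ) (hs : s.Nonempty)
    (hσ : 0 < σ) {v : NNReal} (hv : (v : ℝ) = s.card * σ ^ 2) {φ : ℝ → ℝ} (hφ : CostClass φ)
    (hint : Integrable (fun ω => |Y ω| ^ 3 * deriv φ (|Y ω| / 4)) P) :
    transportCost φ (P.map fun ω => ∑ j ∈ s, X j ω)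
        ((gaussianReal 0 v).map (skewMap v ((∫ ω, Y ω ^ 3 ∂P) / (6 * σ ^ 2)))) ≤
      ENNReal.ofReal (2 * (σ ^ 2 + 2 / σ ^ 2 * ∫ ω, |Y ω| ^ 3 * deriv φ (|Y ω| / 4) ∂P +
        |∫ ω, Y ω ^ 3 ∂P| / σ ^ 2 * (3 * ∫ ω, |Y ω| ∂P + (∫ ω, |Y ω| ^ 3 ∂P) / σ ^ 2) +
        ((∫ ω, Y ω ^ 3 ∂P) / (6 * σ ^ 2)) ^ 2)) := by
  have hv0 := variance_ne_zero hs hσ hv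
  set c := (∫ ω, Y ω ^ 3 ∂P) / (6 * σ ^ 2)
  have hm : AEMeasurable (fun ω => ∑ j ∈ s, X j ω) P := h.memLp_sum.aemeasurable
  have hR : AEMeasurable (skewMap v c) (gaussianReal 0 v) := (continuous_skewMap v c).aemeasurable
  have := Measure.isProbabilityMeasure_map hm
  have := Measure.isProbabilityMeasure_map hR
  have hS2 : MemLp (fun ω => ∑ j ∈ s, X j ω) 2 P :=
    memLp_of_memLp_three h.memLp_sum (by norm_num)
  have hR2 : MemLp (skewMap v c) 2 (gaussianReal 0 v) :=
    (memLp_two_iff_integrable_sq (continuous_skewMap v c).aestronglyMeasurable).2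
      (((polyGrowth_skewMap v c).pow 2).integrable ((continuous_skewMap v c).pow 2) v)
  -- Both laws are centered, as the duality bound requires.
  have ex1 : ∫ x, x ∂(P.map fun ω => ∑ j ∈ s, X j ω) = 0 := by
    rw [integral_map (f := fun x : ℝ => x) hm aestronglyMeasurable_id, integral_finsetSum _ fun i hi =>
      (h.memLp_of_mem hi).integrable (by norm_num)]
    exact Finset.sum_eq_zero fun i hi => h.integral_eq_zero hi
  have ex2 : ∫ x, x ∂((gaussianReal 0 v).map (skewMap v c)) = 0 := by
    rw [integral_map (f := fun x : ℝ => x) hR aestronglyMeasurable_id]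
    simp only [skewMap]
    rw [integral_add (PolyGrowth.id.integrable continuous_id v)
      (((polyGrowth_hermiteTwo v).integrable (continuous_hermiteTwo v) v).const_mul c),
      integral_const_mul, integral_hermiteTwo hv0, integral_id_gaussianReal]
    simp
  obtain ⟨w, hw, hcost⟩ := exists_transportCost_le hφ (P.map fun ω => ∑ j ∈ s, X j ω)
    ((gaussianReal 0 v).map (skewMap v c))
    ((memLp_map_measure_iff aestronglyMeasurable_id hm).2 hS2)
    ((memLp_map_measure_iff aestronglyMeasurable_id hR).2 hR2) (ex1.trans ex2.symm)
  have cw : Continuous w := continuous_of_lipschitz (B := 1) (by simpa using hw)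
  have cp : Continuous fun x => deriv φ (w x) := hφ.continuous_deriv.comp cw
  have hp : LinearGrowth fun x => deriv φ (w x) := LinearGrowth.of_lipschitz (B := 1)
    fun x y => by rw [one_mul]; exact (hφ.abs_deriv_sub_le _ _).trans (hw x y)
  set f : ℝ → ℝ := fun x => ∫ t in (0 : ℝ)..x, deriv φ (w t)
  have hf : ∀ x, HasDerivAt f (deriv φ (w x)) x := fun x =>
    intervalIntegral.integral_hasDerivAt_right (cp.intervalIntegrable _ _)
      cp.aestronglyMeasurable.stronglyMeasurableAtFilter cp.continuousAt
  have cf : Continuous f := continuous_iff_continuousAt.2 fun x => (hf x).continuousAt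
  obtain ⟨C, hC, hfC⟩ := hp.primitive hf
  refine (hcost f hf).trans (ENNReal.ofReal_le_ofReal ?_)
  rw [integral_map hm cf.aestronglyMeasurable, integral_map hR cf.aestronglyMeasurable]
  have h1 := h.integral_sub_le hs hσ hv hφ hw hf hint
  have h2 := integral_comp_skewMap_ge hφ hw hv0 c hf ⟨C, 2, hC, hfC⟩
    (integrable_of_abs_le_sq hR2 cf hfC)
  -- This is what dictates `c`: the skewness term of the Stein expansion cancels exactly.
  have h3 : 3 * v * c = s.card * (∫ ω, Y ω ^ 3 ∂P) / 2 := by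
    rw [hv]
    simp only [c]
    field_simp
    ring
  rw [h3] at h2
  linarith

/-- The bound of the main theorem for a finite centered family. -/
lemma transportDist_le (h : CenteredFamily P s X Y σ) (hs : s.Nonempty)
    (hσ : 0 < σ) {v : NNReal} (hv : (v : ℝ) = s.card * σ ^ 2) {φ : ℝ → ℝ} (hφ : CostClass φ) :
    transportDist φ (P.map fun ω => ∑ j ∈ s, X j ω) (gaussianReal 0 v) ≤
      (ENNReal.ofReal (2 * constC₀ P Y) + ENNReal.ofReal (8 * 0.64584 * (σ ^ 2)⁻¹) *
        ∫⁻ ω, ENNReal.ofReal (|Y ω| ^ 3 * deriv φ (|Y ω| / 4)) ∂P) ^ (1 / 2 : ℝ) +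
      ENNReal.ofReal (1.369 * (σ ^ 2)⁻¹ * |∫ ω, Y ω ^ 3 ∂P|) := by
  have hnn : ∀ ω, 0 ≤ |Y ω| ^ 3 * deriv φ (|Y ω| / 4) := fun ω =>
    mul_nonneg (by positivity) (hφ.deriv_nonneg (by positivity))
  have hmeas : AEStronglyMeasurable (fun ω => |Y ω| ^ 3 * deriv φ (|Y ω| / 4)) P := by
    have : Continuous fun x : ℝ => |x| ^ 3 * deriv φ (|x| / 4) := by
      have := hφ.continuous_deriv
      fun_prop
    exact this.comp_aestronglyMeasurable h.memLp.aestronglyMeasurable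
  by_cases hfin : ∫⁻ ω, ENNReal.ofReal (|Y ω| ^ 3 * deriv φ (|Y ω| / 4)) ∂P = ∞
  · rw [hfin, ENNReal.mul_top (by rw [ne_eq, ENNReal.ofReal_eq_zero, not_le]; positivity),
      add_top, ENNReal.top_rpow_of_pos (by norm_num), top_add]
    exact le_top
  have hint : Integrable (fun ω => |Y ω| ^ 3 * deriv φ (|Y ω| / 4)) P :=
    (lintegral_ofReal_ne_top_iff_integrable hmeas (Eventually.of_forall hnn)).1 hfin
  have hv0 := variance_ne_zero hs hσ hv
  set c := (∫ ω, Y ω ^ 3 ∂P) / (6 * σ ^ 2) with hc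
  have hR : AEMeasurable (skewMap v c) (gaussianReal 0 v) := (continuous_skewMap v c).aemeasurable
  have := Measure.isProbabilityMeasure_map hR
  refine (transportDist_triangle hφ _ ((gaussianReal 0 v).map (skewMap v c)) _).trans
    (add_le_add (ENNReal.rpow_le_rpow ((h.transportCost_le hs hσ hv hφ hint).trans ?_)
      (by norm_num)) ((transportDist_skewMap_le hφ hv0 c).trans (ENNReal.ofReal_le_ofReal ?_)))
  · rw [← ofReal_integral_eq_lintegral_ofReal hint (Eventually.of_forall hnn),
      ← ENNReal.ofReal_mul (by positivity)]
    have hE1 := h.integral_abs_le hσ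
    have hR0 : 0 ≤ ∫ ω, |Y ω| ^ 3 * deriv φ (|Y ω| / 4) ∂P := integral_nonneg hnn
    have hE3 : 0 ≤ ∫ ω, |Y ω| ^ 3 ∂P := integral_nonneg fun ω => by positivity
    have hC : constC₀ P Y = 3.0376 * σ ^ 2 + 3 / 5 * ((∫ ω, |Y ω| ^ 3 ∂P) / σ ^ 2) ^ 2 +
        1.6917 * (|∫ ω, Y ω ^ 3 ∂P| / σ ^ 2) ^ 2 := by
      rw [constC₀, h.var, div_pow, div_pow, sq_abs]
      field_simp
      ring
    have hc2 : c ^ 2 = (|∫ ω, Y ω ^ 3 ∂P| / σ ^ 2) ^ 2 / 36 := by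
      rw [hc, div_pow, div_pow, sq_abs]
      field_simp
      norm_num
    rw [hC, hc2]
    generalize ∫ ω, |Y ω| ^ 3 * deriv φ (|Y ω| / 4) ∂P = R at *
    generalize hd : |∫ ω, Y ω ^ 3 ∂P| / σ ^ 2 = d
    generalize (∫ ω, |Y ω| ^ 3 ∂P) / σ ^ 2 = a
    have hd0 : 0 ≤ d := by rw [← hd]; positivity
    have hRσ : 0 ≤ (σ ^ 2)⁻¹ * R := by positivity
    have hdE : d * (3 * ∫ ω, |Y ω| ∂P + a) ≤ d * (3 * σ + a) :=
      mul_le_mul_of_nonneg_left (by linarith) hd0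
    rw [← ENNReal.ofReal_add (by positivity) (by positivity)]
    refine ENNReal.ofReal_le_ofReal ?_
    rw [div_eq_mul_inv 2]
    -- Weighted squares: `a d ≤ (3/5) a² + (5/12) d²` and `3 d σ ≤ 2 σ² + (9/8) d²`. The
    -- coefficients needed are then `3` for `σ²` and `5/12 + 9/8 + 1/36 < 1.6917` for `d²`.
    have key : σ ^ 2 + d * (3 * σ + a) + d ^ 2 / 36 ≤
        3.0376 * σ ^ 2 + 3 / 5 * a ^ 2 + 1.6917 * d ^ 2 := by
      nlinarith [sq_nonneg (a - 5 / 6 * d), sq_nonneg (σ - 3 / 4 * d)]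
    linarith
  -- The correction costs `|c| = |μ₃| / (6 σ²)`, and `1/6 ≤ 1.369`.
  · rw [hc, abs_div, abs_of_pos (by positivity : (0 : ℝ) < 6 * σ ^ 2), div_eq_mul_inv, mul_inv]
    have : 0 ≤ (σ ^ 2)⁻¹ * |∫ ω, Y ω ^ 3 ∂P| := by positivity
    linarith

end CenteredFamily

/-! ### The main theorem. -/

theorem theorem2p2 {Ω : Type*} [MeasurableSpace Ω] (P : Measure Ω) [IsProbabilityMeasure P]
    (X : ℤ → Ω → ℝ) (hindep : iIndepFun X P)
    (hident : ∀ i, IdentDistrib (X i) (X 1) P P)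
    (hL3 : MemLp (X 1) 3 P) (hcent : ∫ ω, X 1 ω ∂P = 0)
    (σ : ℝ) (hσ : 0 < σ) (hvar : ∫ ω, X 1 ω ^ 2 ∂P = σ ^ 2)
    (φ : ℝ → ℝ) (hφ : CostClass φ) :
    (∀ n : ℕ, 1 ≤ n →
      transportDist φ (P.map (fun ω => ∑ k ∈ Finset.Icc (1 : ℤ) n, X k ω))
          (gaussianReal 0 (Real.toNNReal (n * σ ^ 2))) ≤
        (ENNReal.ofReal (2 * constC₀ P (X 1))
          + ENNReal.ofReal (8 * 0.64584 * (σ ^ 2)⁻¹)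
            * ∫⁻ ω, ENNReal.ofReal (|X 1 ω| ^ 3 * deriv φ (|X 1 ω| / 4)) ∂P) ^ (1 / 2 : ℝ)
        + ENNReal.ofReal (1.369 * (σ ^ 2)⁻¹ * |∫ ω, X 1 ω ^ 3 ∂P|)) ∧
    (∫⁻ ω, ENNReal.ofReal (X 1 ω ^ 2 * φ |X 1 ω|) ∂P < ∞ →
      ∃ C : NNReal, ∀ n : ℕ, 1 ≤ n →
        transportDist φ (P.map (fun ω => ∑ k ∈ Finset.Icc (1 : ℤ) n, X k ω))
          (gaussianReal 0 (Real.toNNReal (n * σ ^ 2))) ≤ C) := by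
  have hbound : ∀ n : ℕ, 1 ≤ n →
      transportDist φ (P.map (fun ω => ∑ k ∈ Finset.Icc (1 : ℤ) n, X k ω))
          (gaussianReal 0 (Real.toNNReal (n * σ ^ 2))) ≤
        (ENNReal.ofReal (2 * constC₀ P (X 1))
          + ENNReal.ofReal (8 * 0.64584 * (σ ^ 2)⁻¹)
            * ∫⁻ ω, ENNReal.ofReal (|X 1 ω| ^ 3 * deriv φ (|X 1 ω| / 4)) ∂P) ^ (1 / 2 : ℝ)
        + ENNReal.ofReal (1.369 * (σ ^ 2)⁻¹ * |∫ ω, X 1 ω ^ 3 ∂P|) := by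
    intro n hn
    have hfam : CenteredFamily P (Finset.Icc (1 : ℤ) n) X (X 1) σ := by
      refine ⟨fun k hk => ?_, fun k _ => hident k, hL3, hcent, hvar⟩
      have h1 := hindep.indepFun_finsetSum_of_notMem₀ (fun i => (hident i).aemeasurable_fst)
        (Finset.notMem_erase k (Finset.Icc (1 : ℤ) n))
      convert h1 using 1
      funext ω
      rw [Finset.sum_apply, ← Finset.sum_erase_add _ _ hk, add_sub_cancel_right]
    refine hfam.transportDist_le ⟨1, Finset.mem_Icc.2 ⟨le_rfl, by exact_mod_cast hn⟩⟩ hσ ?_ hφ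
    rw [Real.coe_toNNReal _ (by positivity)]
    simp
  refine ⟨hbound, fun hfin => ?_⟩
  -- Pointwise `|x|³ φ'(|x| / 4) ≤ (4/3) x² φ(|x|)`, so the right-hand side of the bound, which does
  -- not involve `n`, is finite.
  have hmom : ∫⁻ ω, ENNReal.ofReal (|X 1 ω| ^ 3 * deriv φ (|X 1 ω| / 4)) ∂P ≠ ∞ := by
    refine ne_top_of_le_ne_top (ENNReal.mul_ne_top (a := ENNReal.ofReal (4 / 3))
      ENNReal.ofReal_ne_top hfin.ne) ?_
    rw [← lintegral_const_mul' _ _ ENNReal.ofReal_ne_top]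
    refine lintegral_mono fun ω => ?_
    rw [← ENNReal.ofReal_mul (by norm_num)]
    refine ENNReal.ofReal_le_ofReal ?_
    have h1 := mul_le_mul_of_nonneg_left (hφ.mul_deriv_div_four_le (abs_nonneg (X 1 ω)))
      (sq_nonneg |X 1 ω|)
    rw [← sq_abs (X 1 ω)]
    linarith
  exact ⟨_, fun n hn => (hbound n hn).trans_eq (ENNReal.coe_toNNReal
    (ENNReal.add_ne_top.2 ⟨ENNReal.rpow_ne_top_of_nonneg (by norm_num)
      (ENNReal.add_ne_top.2 ⟨ENNReal.ofReal_ne_top,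
        ENNReal.mul_ne_top ENNReal.ofReal_ne_top hmom⟩), ENNReal.ofReal_ne_top⟩)).symm⟩
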